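/- **Conventions.** A graph $G$ consists of finite sets $V_G$ (vertices) and $E^{\rm dir}_G$ (directed edges), maps $t_G,h_G\colon E^{\rm dir}_G\to V_G$ (tails and heads), and an involution $\iota_G$ of $E^{\rm dir}_G$ with $t_G\iota_G=h_G$ (multiple edges and loops, including half-loops $\iota_G e=e$, are allowed). Its edge set $E_G$ is the set of $\iota_G$-orbits and its order is ${\rm ord}(G)=\#E_G-\#V_G$. Its Hashimoto matrix $H_G$ is indexed by $E^{\rm dir}_G$ and has $(e_1,e_2)$-entry $1$ if $h_G e_1=t_G e_2$ and $\iota_G e_1\ne e_2$, and $0$ otherwise; $\mu_1(G)$ is its Perron–Frobenius eigenvalue, i.e. its spectral radius ($0$ if there are no edges). A graph is connected if it is non-empty and any two vertices are joined by a walk. For $\nu\in\mathbb R$ and $r\in\mathbb N$, ${\rm TangleFree}(\ge\nu,<r)$ is the set of graphs having no connected subgraph $\psi$ with $\mu_1(\psi)\ge\nu$ and ${\rm ord}(\psi)<r$. Let $B$ be a graph. A coordinatized cover of $B$ of degree $n$ is a graph $G$ with $V_G=V_B\times[n]$, $E^{\rm dir}_G=E^{\rm dir}_B\times[n]$, $t_G(e,i)=(t_Be,i)$,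 $h_G(e,i)=(h_Be,\sigma(e)i)$, $\iota_G(e,i)=(\iota_Be,\sigma(e)i)$ for a map $\sigma$ from $E^{\rm dir}_B$ to the permutations of $[n]$ with $\sigma(\iota_Be)=\sigma(e)^{-1}$. Its new Hashimoto spectrum ${\rm Spec}^{\rm new}_B(H_G)$ is the multiset of eigenvalues, with algebraic multiplicity, of $H_G$ on the space of functions $E^{\rm dir}_G\to\mathbb C$ whose sum over each fibre of $E^{\rm dir}_G\to E^{\rm dir}_B$ is $0$. A model over $B$ is a family $\{\mathcal C_n(B)\}_{n\in N}$, with $N$ an infinite set of positive integers, of finite probability spaces, the atoms of $\mathcal C_n(B)$ being coordinatized covers of $B$ of degree $n$. For $U\subset V_G$ let $\Gamma_G(U)$ be the set of vertices joined by an edge to a vertex of $U$. For real $\gamma>0$ and $R\in\mathbb N$, $G$ is an $(R,\gamma)$-pseudo-magnifier if $\#(\Gamma_G(U)\setminus U)\ge\gamma\,\#U$ for all $U\subset V_G$ with $R\le\#U\le(\#V_G)/2$. A model is pseudo-magnifying if for every $i\in\mathbb N$ there are $\gamma>0$ and $R\in\mathbb N$ such that the probability that $G\in\mathcal C_n(B)$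 is not an $(R,\gamma)$-pseudo-magnifier is $O(n^{-i})$. **Lemma.** Let $\{\mathcal C_n(B)\}_{n\in N}$ be a pseudo-magnifying model (algebraic or not; in particular, any pseudo-magnifying algebraic model) over a connected graph $B$. Then for every $i\in\mathbb N$ and every real $\theta>0$ there is an $r\in\mathbb N$ such that, for $\ell=\mu_1(B)$ and all real $\nu\le\mu_1(B)$, $$ \mathbb E_{G\in\mathcal C_n(B)}\Bigl[\mathbb I_{{\rm TangleFree}(\ge\nu,<r)}(G)\cdot\#\bigl\{\lambda\in{\rm Spec}^{\rm new}_B(H_G) : |\lambda-\ell|\le n^{-\theta}\bigr\}\Bigr]=O(n^{-i})\qquad(n\in N), $$ where eigenvalues are counted with multiplicity and the implied constant does not depend on $n$ or $\nu$. -/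

import Mathlib

/-- A (multi)graph with vertex set `V` and set of directed edges `E`: tails `t`, heads `h` and an
involution `ι` on directed edges with `t ∘ ι = h`. Multiple edges are allowed, as are half-loops
(`ι e = e`) and whole-loops (`ι e ≠ e` and `h e = t e`). -/
structure InvGraph (V : Type*) (E : Type*) where
  t : E → V
  h : E → V
  ι : E → E
  ι_ι : ∀ e, ι (ι e) = e
  t_ι : ∀ e, t (ι e) = h e

namespace InvGraph

section basic

variable {V : Type*} {E : Type*}

/-- Any two vertices are joined by a walk (and there is a vertex). -/
def Connected (G : InvGraph V E) : Prop :=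
  Nonempty V ∧ ∀ u v : V, Relation.ReflTransGen (fun a b => ∃ e, G.t e = a ∧ G.h e = b) u v

/-- Two directed edges are equivalent if they lie in the same `ι`-orbit. -/
def edgeSetoid (G : InvGraph V E) : Setoid E where
  r e e' := e' = e ∨ e' = G.ι e
  iseqv :=
    { refl := fun _ => Or.inl rfl
      symm := by
        rintro x y (rfl | rfl)
        · exact Or.inl rfl
        · exact Or.inr (G.ι_ι x).symm
      trans := by
        rintro x y z (rfl | rfl) (rfl | rfl)
        · exact Or.inl rfl
        · exact Or.inr rfl
        · exact Or.inr rfl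
        · exact Or.inl (G.ι_ι x) }

/-- The set of (undirected) edges: the `ι`-orbits of directed edges. -/
def Edge (G : InvGraph V E) : Type _ := Quotient G.edgeSetoid

/-- The order `#E_G - #V_G` of a finite graph; a half-loop and a whole-loop each count as one
edge. -/
noncomputable def order (G : InvGraph V E) : ℤ := (Nat.card G.Edge : ℤ) - (Nat.card V : ℤ)

/-- The Hashimoto (non-backtracking) matrix, indexed by directed edges. -/
def hashimoto [DecidableEq V] [DecidableEq E] (G : InvGraph V E) : Matrix E E ℂ :=
  fun e₁ e₂ => if G.h e₁ = G.t e₂ ∧ G.ι e₁ ≠ e₂ then 1 else 0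

/-- The Perron-Frobenius eigenvalue of the (entrywise nonnegative) Hashimoto matrix, i.e. its
spectral radius. -/
noncomputable def mu1 [DecidableEq V] [DecidableEq E] [Fintype E] (G : InvGraph V E) : ℝ :=
  (spectralRadius ℂ G.hashimoto).toReal

/-- A subgraph: sets of vertices and directed edges closed under tails, heads and `ι`. -/
structure Subgraph (G : InvGraph V E) where
  verts : Finset V
  edges : Finset E
  t_mem : ∀ e ∈ edges, G.t e ∈ verts
  h_mem : ∀ e ∈ edges, G.h e ∈ verts
  ι_mem : ∀ e ∈ edges, G.ι e ∈ edges

/-- A subgraph as a graph in its own right. -/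
def Subgraph.toGraph {G : InvGraph V E} (S : G.Subgraph) :
    InvGraph {v // v ∈ S.verts} {e // e ∈ S.edges} where
  t e := ⟨G.t e, S.t_mem e e.2⟩
  h e := ⟨G.h e, S.h_mem e e.2⟩
  ι e := ⟨G.ι e, S.ι_mem e e.2⟩
  ι_ι e := Subtype.ext (G.ι_ι e)
  t_ι e := Subtype.ext (G.t_ι e)

/-- `G` is a `(≥ ν, < r)`-tangle. -/
def IsTangle [DecidableEq V] [DecidableEq E] [Fintype E] (ν : ℝ) (r : ℕ) (G : InvGraph V E) :
    Prop :=
  G.Connected ∧ ν ≤ G.mu1 ∧ G.order < (r : ℤ)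

/-- `G ∈ TangleFree(≥ ν, < r)`: no subgraph of `G` is a `(≥ ν, < r)`-tangle. -/
def TangleFree [DecidableEq V] [DecidableEq E] (ν : ℝ) (r : ℕ) (G : InvGraph V E) : Prop :=
  ∀ S : G.Subgraph, ¬ S.toGraph.IsTangle ν r

open Classical in
/-- The neighbourhood of `U`: the vertices joined by an edge to a vertex of `U`. -/
noncomputable def nbhd [Fintype V] (G : InvGraph V E) (U : Finset V) : Finset V :=
  Finset.univ.filter fun v => ∃ e, G.t e ∈ U ∧ G.h e = v

/-- `(R, γ)`-pseudo-magnifiers. -/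
def IsPseudoMagnifier [Fintype V] [DecidableEq V] (R : ℕ) (γ : ℝ) (G : InvGraph V E) : Prop :=
  ∀ U : Finset V, R ≤ U.card → (U.card : ℝ) ≤ (Fintype.card V : ℝ) / 2 →
    γ * (U.card : ℝ) ≤ ((G.nbhd U \ U).card : ℝ)

/-- The permutation assignments `σ` over `B` of degree `n`. The coordinatized covers of `B` of
degree `n` are in bijection with them. -/
abbrev Coord (B : InvGraph V E) (n : ℕ) : Type _ :=
  {σ : E → Equiv.Perm (Fin n) // ∀ e, σ (B.ι e) = (σ e)⁻¹}

/-- The coordinatized cover of `B` with permutation assignment `σ`. -/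
def Coord.cover {B : InvGraph V E} {n : ℕ} (σ : B.Coord n) :
    InvGraph (V × Fin n) (E × Fin n) where
  t p := (B.t p.1, p.2)
  h p := (B.h p.1, σ.1 p.1 p.2)
  ι p := (B.ι p.1, σ.1 p.1 p.2)
  ι_ι p := by
    refine Prod.ext (B.ι_ι p.1) ?_
    simp [σ.2]
  t_ι p := Prod.ext (B.t_ι p.1) rfl

end basic

section newSpectrum

variable {V : Type*} {E : Type*}

/-- The new functions on the directed edges of a degree `n` cover: those whose sum over each fibre
of the projection to the directed edges of the base vanishes. -/
def newFunctions (E : Type*) (n : ℕ) : Submodule ℂ (E × Fin n → ℂ) where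
  carrier := {f | ∀ e, ∑ i, f (e, i) = 0}
  add_mem' := by
    intro f g hf hg e
    simp [Finset.sum_add_distrib, hf e, hg e]
  zero_mem' := by
    intro e
    simp
  smul_mem' := by
    intro c f hf e
    simp [← Finset.mul_sum, hf e]

variable [DecidableEq V] [DecidableEq E] [Fintype E]

theorem hashimoto_cover_mulVec {B : InvGraph V E} {n : ℕ} (σ : B.Coord n)
    (f : E × Fin n → ℂ) (e : E) (i : Fin n) :
    (σ.cover.hashimoto.mulVec f) (e, i) = ∑ e', B.hashimoto e e' * f (e', σ.1 e i) := by
  simp only [Matrix.mulVec, dotProduct, Fintype.sum_prod_type]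
  refine Finset.sum_congr rfl fun e' _ => ?_
  rw [Finset.sum_eq_single (σ.1 e i)]
  · simp [hashimoto, Coord.cover]
  · intro j _ hj
    simp [hashimoto, Coord.cover, hj.symm]
  · simp

/-- The Hashimoto operator of a cover preserves the space of new functions. -/
theorem hashimoto_cover_newFunctions {B : InvGraph V E} {n : ℕ} (σ : B.Coord n) :
    ∀ f ∈ newFunctions E n, Matrix.toLin' σ.cover.hashimoto f ∈ newFunctions E n := by
  intro f hf e
  simp only [Matrix.toLin'_apply, hashimoto_cover_mulVec]
  rw [Finset.sum_comm]
  refine Finset.sum_eq_zero fun e' _ => ?_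
  rw [← Finset.mul_sum, Equiv.sum_comp (σ.1 e) fun j => f (e', j), hf e', mul_zero]

/-- The new Hashimoto spectrum of a cover of `B`: the eigenvalues, with algebraic multiplicity, of
the Hashimoto operator of the cover acting on the new functions. -/
noncomputable def Coord.newSpec {B : InvGraph V E} {n : ℕ} (σ : B.Coord n) : Multiset ℂ :=
  ((Matrix.toLin' σ.cover.hashimoto).restrict (hashimoto_cover_newFunctions σ)).charpoly.roots

open Classical in
/-- The number, counted with multiplicity, of new Hashimoto eigenvalues at distance at most `ρ`
from `ℓ`. -/
noncomputable def Coord.newCount {B : InvGraph V E} {n : ℕ} (σ : B.Coord n) (ℓ : ℂ) (ρ : ℝ) : ℕ :=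
  (σ.newSpec.filter fun z => z ∈ Metric.closedBall ℓ ρ).card

end newSpectrum

/-- A model over `B`: an infinite set of degrees and, for each degree `n` in it, a finite
probability space whose atoms are coordinatized covers of `B` of degree `n`. -/
structure Model {V : Type*} {E : Type*} (B : InvGraph V E) where
  degrees : Set ℕ
  infinite : degrees.Infinite
  pos : ∀ n ∈ degrees, 0 < n
  law : ∀ n : degrees, PMF (B.Coord n)

namespace Model

variable {V : Type*} {E : Type*} [Fintype E] [DecidableEq E] {B : InvGraph V E}

/-- The expected value of a random variable on the space of covers of degree `n`. -/
noncomputable def expect (M : B.Model) (n : M.degrees) (X : B.Coord n → ℝ) : ℝ :=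
  letI : Fintype (B.Coord n) := Fintype.ofFinite _
  ∑ σ : B.Coord n, (M.law n σ).toReal * X σ

open Classical in
/-- The probability of an event in the space of covers of degree `n`. -/
noncomputable def prob (M : B.Model) (n : M.degrees) (A : B.Coord n → Prop) : ℝ :=
  M.expect n fun σ => if A σ then 1 else 0

/-- For every `i` there are `γ > 0` and `R` such that the probability that the cover is not an
`(R, γ)`-pseudo-magnifier is `O(n ^ (-i))`. -/
def PseudoMagnifying [Fintype V] [DecidableEq V] (M : B.Model) : Prop :=
  ∀ i : ℕ, 1 ≤ i → ∃ γ : ℝ, 0 < γ ∧ ∃ R : ℕ, 1 ≤ R ∧ ∃ C : ℝ, ∀ n : M.degrees,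
    M.prob n (fun σ => ¬ σ.cover.IsPseudoMagnifier R γ) ≤ C * ((n : ℕ) : ℝ) ^ (-(i : ℝ))

end Model

end InvGraph

/-! Write `ℓ` for the Perron-Frobenius eigenvalue of `B`. The point is a spectral gap uniform in
`n`: a large cover that is both tangle-free and a pseudo-magnifier has no new eigenvalue within a
fixed distance of `ℓ`.

A vertex set with no neighbour outside contains a connected component of the cover; functions on `B`
pull back to it, so its Perron-Frobenius eigenvalue is at least `ℓ`, and if it is small its order is
small. Tangle-freeness forbids this, so small sets expand too and the cover is a genuine magnifier
(`isMagnifier_of_tangleFree`).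

Let `ℓ > 1`. By Ihara-Bass the vertex sums `S` of a Hashimoto eigenfunction satisfy `(z² - 1 + deg)
S = z Adj S`. The positive solution `f` for `ℓ` on `B` lifts to the cover. For a new eigenfunction
put `S = f h`; then `h` has sum zero, because `f` is constant on fibres. The ground-state transform
bounds the Dirichlet form of `h` by a multiple of `|z - ℓ| ∑ |h|²`, while Cheeger's inequality
bounds it below by a multiple of `∑ |h|²` (`gap_le`).

If `ℓ ≤ 1`, then `B` and its covers have at most two directed edges per vertex, so a connected cover
is a tree with at most two extra directed edges. It has a balanced cut with at most three boundary
vertices, so magnifiers of this kind have bounded size. `exists_gap` joins the two cases.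

For large `n` only covers that are not pseudo-magnifiers contribute. Each contributes at most `#E *
n`, and their probability is `O(n^(-i-1))`. -/

set_option linter.unusedSectionVars false

/-! ### Weak Perron-Frobenius theory for nonnegative matrices -/

section Perron

open Filter Topology Matrix

attribute [local instance] Matrix.linftyOpNormedRing Matrix.linftyOpNormedAlgebra

variable {E : Type*} [Fintype E] [DecidableEq E]

theorem Matrix.exists_mem_spectrum_norm_eq_spectralRadius [Nonempty E] (A : Matrix E E ℂ) :
    ∃ z ∈ spectrum ℂ A, ‖z‖ = (spectralRadius ℂ A).toReal := by
  obtain ⟨z, hz, h⟩ := spectrum.exists_nnnorm_eq_spectralRadius A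
  exact ⟨z, hz, by rw [← h]; simp⟩

theorem Matrix.spectralRadius_ne_top (A : Matrix E E ℂ) : spectralRadius ℂ A ≠ ⊤ := by
  rcases isEmpty_or_nonempty E with hE | hE
  · rw [Subsingleton.elim A 0]
    simp
  · obtain ⟨z, hz, h⟩ := spectrum.exists_nnnorm_eq_spectralRadius A
    rw [← h]
    simp

theorem Matrix.norm_le_spectralRadius_toReal (A : Matrix E E ℂ) {z : ℂ} (hz : z ∈ spectrum ℂ A) :
    ‖z‖ ≤ (spectralRadius ℂ A).toReal := by
  have h : (‖z‖₊ : ENNReal) ≤ spectralRadius ℂ A :=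
    le_iSup₂ (f := fun (k : ℂ) (_ : k ∈ spectrum ℂ A) => (‖k‖₊ : ENNReal)) z hz
  simpa using ENNReal.toReal_mono A.spectralRadius_ne_top h

theorem Matrix.map_ofReal_pow_mulVec_apply (A : Matrix E E ℝ) (k : ℕ) (e : E) :
    ((A.map Complex.ofReal) ^ k *ᵥ (fun _ => (1 : ℂ))) e
      = (((A ^ k *ᵥ fun _ => (1 : ℝ)) e : ℝ) : ℂ) := by
  have h : (A.map Complex.ofReal) ^ k = (A ^ k).map Complex.ofReal :=
    (map_pow (Complex.ofRealHom.mapMatrix (m := E)) A k).symm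
  rw [h]
  simp [Matrix.mulVec, dotProduct]

/-- Gelfand's formula, in the operator norm for the sup norm, where the constant function `1` has
norm `1`. -/
theorem Matrix.exists_pow_mulVec_one_le [Nonempty E] (A : Matrix E E ℝ) {y : ℝ}
    (hy : (spectralRadius ℂ (A.map Complex.ofReal)).toReal < y) :
    ∀ᶠ k : ℕ in atTop, ∀ e, ‖(A ^ k *ᵥ fun _ => (1 : ℝ)) e‖ ≤ y ^ k := by
  set A' := A.map Complex.ofReal with hA'
  have hy0 : 0 < y := ENNReal.toReal_nonneg.trans_lt hy
  have h1 : spectralRadius ℂ A' < ENNReal.ofReal y :=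
    (ENNReal.lt_ofReal_iff_toReal_lt A'.spectralRadius_ne_top).2 hy
  have h2 := (spectrum.pow_norm_pow_one_div_tendsto_nhds_spectralRadius A').eventually_lt_const h1
  filter_upwards [h2, eventually_gt_atTop 0] with k hk hk0 e
  have h3 : ‖A' ^ k‖ ^ (1 / k : ℝ) < y := (ENNReal.ofReal_lt_ofReal_iff hy0).1 hk
  have h4 : ‖A' ^ k‖ ≤ y ^ k := by
    have := pow_le_pow_left₀ (by positivity) h3.le k
    rwa [← Real.rpow_natCast (‖A' ^ k‖ ^ (1 / k : ℝ)), ← Real.rpow_mul (norm_nonneg _),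
      one_div_mul_cancel (by positivity), Real.rpow_one] at this
  have h5 := Matrix.linfty_opNorm_mulVec (A' ^ k) (fun _ => (1 : ℂ))
  have h6 := norm_le_pi_norm (A' ^ k *ᵥ fun _ => (1 : ℂ)) e
  rw [A.map_ofReal_pow_mulVec_apply, Complex.norm_real] at h6
  have h7 : ‖(fun _ : E => (1 : ℂ))‖ = 1 := by simp
  rw [h7, mul_one] at h5
  linarith

/-- Above the spectral radius, the resolvent of a nonnegative matrix maps the constant function `1`
to a nonnegative function. -/
theorem Matrix.exists_nonneg_resolvent_one (A : Matrix E E ℝ) (hA : ∀ i j, 0 ≤ A i j) {x : ℝ}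
    (hx : (spectralRadius ℂ (A.map Complex.ofReal)).toReal < x) :
    ∃ g : E → ℝ, (∀ e, 0 ≤ g e) ∧ ∀ e, x * g e = (A *ᵥ g) e + 1 := by
  rcases isEmpty_or_nonempty E with hE | hE
  · exact ⟨fun _ => 0, fun _ => le_rfl, fun e => hE.elim e⟩
  -- The room between `y` and `x` makes the Neumann series `∑ A^k 1 / x^(k+1)` converge
  -- geometrically; its sum is the witness.
  obtain ⟨y, hy, hyx⟩ := exists_between hx
  have hy0 : 0 < y := ENNReal.toReal_nonneg.trans_lt hy
  have hx0 : 0 < x := hy0.trans hyx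
  set a : ℕ → E → ℝ := fun k => A ^ k *ᵥ fun _ => (1 : ℝ) with ha
  have hsucc : ∀ k, a (k + 1) = A *ᵥ a k := fun k => by
    simp only [ha, pow_succ', Matrix.mulVec_mulVec]
  have ha0 : ∀ k e, 0 ≤ a k e := by
    intro k
    induction k with
    | zero => intro e; simp [ha]
    | succ k ih =>
      intro e
      rw [hsucc]
      exact Finset.sum_nonneg fun e' _ => mul_nonneg (hA _ _) (ih _)
  have hsum : ∀ e, Summable fun k => a k e / x ^ (k + 1) := by
    intro e
    have hgeo : Summable fun k : ℕ => x⁻¹ * (y / x) ^ k :=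
      (summable_geometric_of_lt_one (by positivity) ((div_lt_one hx0).2 hyx)).mul_left _
    refine Summable.of_norm_bounded_eventually_nat hgeo ?_
    filter_upwards [A.exists_pow_mulVec_one_le hy] with k hk
    have := hk e
    rw [norm_div, norm_pow, Real.norm_of_nonneg hx0.le, div_pow, pow_succ', inv_mul_eq_div,
      div_div, mul_comm x]
    gcongr
  refine ⟨fun e => ∑' k, a k e / x ^ (k + 1), fun e => tsum_nonneg fun k => by
    have := ha0 k e; positivity, fun e => ?_⟩
  have h1 : (A *ᵥ fun e => ∑' k, a k e / x ^ (k + 1)) e = ∑' k, a (k + 1) e / x ^ (k + 1) := by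
    simp only [Matrix.mulVec, dotProduct, ← tsum_mul_left]
    rw [← Summable.tsum_finsetSum fun e' _ => (hsum e').mul_left _]
    refine tsum_congr fun k => ?_
    rw [hsucc]
    simp only [Matrix.mulVec, dotProduct, Finset.sum_div, mul_div_assoc]
  rw [h1]
  beta_reduce
  rw [(hsum e).tsum_eq_zero_add, mul_add, add_comm, ← tsum_mul_left]
  have h2 : x * (a 0 e / x ^ (0 + 1)) = 1 := by
    simp [ha, hx0.ne']
  rw [h2]
  congr 1
  refine tsum_congr fun k => ?_
  field_simp
  ring

/-- A positive function strictly decreased by a nonnegative matrix bounds its spectrum. -/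
theorem Matrix.spectralRadius_le_of_mulVec_le [Nonempty E] (A : Matrix E E ℝ)
    (hA : ∀ i j, 0 ≤ A i j) {ρ : ℝ} {g : E → ℝ} (hg : ∀ e, 0 < g e)
    (hρ : ∀ e, (A *ᵥ g) e ≤ ρ * g e) :
    (spectralRadius ℂ (A.map Complex.ofReal)).toReal ≤ ρ := by
  obtain ⟨z, hz, hzl⟩ := (A.map Complex.ofReal).exists_mem_spectrum_norm_eq_spectralRadius
  rw [← hzl]
  rw [← Matrix.spectrum_toLin', ← Module.End.hasEigenvalue_iff_mem_spectrum] at hz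
  obtain ⟨v, hv⟩ := hz.exists_hasEigenvector
  have hv1 : ∀ e, ∑ e', (A e e' : ℂ) * v e' = z * v e := fun e => by
    have := congrFun hv.apply_eq_smul e
    simpa [Matrix.toLin'_apply, Matrix.mulVec, dotProduct] using this
  -- The eigenvalue equation is evaluated where `‖v‖ / g` is largest, so that `c * g` dominates
  -- `‖v‖` with equality there.
  obtain ⟨e₀, -, he₀⟩ := Finset.exists_max_image Finset.univ (fun e => ‖v e‖ / g e)
    Finset.univ_nonempty
  set c := ‖v e₀‖ / g e₀ with hc
  have hvc : ∀ e, ‖v e‖ ≤ c * g e := fun e => (div_le_iff₀ (hg e)).1 (he₀ e (Finset.mem_univ _))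
  have hv0 : 0 < ‖v e₀‖ := by
    obtain ⟨e, he⟩ := Function.ne_iff.1 hv.2
    have h1 : 0 < ‖v e‖ := norm_pos_iff.2 he
    have h2 : 0 < c * g e := h1.trans_le (hvc e)
    have h3 : 0 < c := pos_of_mul_pos_left h2 (hg e).le
    rw [hc] at h3
    exact (div_pos_iff_of_pos_right (hg e₀)).1 h3
  have hc0 : 0 ≤ c := by have := hg e₀; positivity
  have h4 : ‖z‖ * ‖v e₀‖ ≤ ρ * ‖v e₀‖ := by
    calc ‖z‖ * ‖v e₀‖ = ‖∑ e', (A e₀ e' : ℂ) * v e'‖ := by rw [hv1, norm_mul]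
      _ ≤ ∑ e', ‖(A e₀ e' : ℂ) * v e'‖ := norm_sum_le _ _
      _ ≤ ∑ e', A e₀ e' * (c * g e') := by
        refine Finset.sum_le_sum fun e' _ => ?_
        rw [norm_mul, Complex.norm_real, Real.norm_of_nonneg (hA _ _)]
        exact mul_le_mul_of_nonneg_left (hvc e') (hA _ _)
      _ = c * (A *ᵥ g) e₀ := by
        simp only [Matrix.mulVec, dotProduct, Finset.mul_sum]
        exact Finset.sum_congr rfl fun _ _ => by ring
      _ ≤ c * (ρ * g e₀) := mul_le_mul_of_nonneg_left (hρ e₀) hc0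
      _ = ρ * ‖v e₀‖ := by rw [hc]; field_simp [(hg e₀).ne']
  exact le_of_mul_le_mul_right h4 hv0

/-- **Perron-Frobenius theorem**, weak form: the spectral radius of a nonnegative matrix is an
eigenvalue with a nonnegative eigenvector. -/
theorem Matrix.exists_nonneg_eigenvector [Nonempty E] (A : Matrix E E ℝ) (hA : ∀ i j, 0 ≤ A i j) :
    ∃ g : E → ℝ, (∀ e, 0 ≤ g e) ∧ g ≠ 0 ∧
      A *ᵥ g = (spectralRadius ℂ (A.map Complex.ofReal)).toReal • g := by
  set ℓ := (spectralRadius ℂ (A.map Complex.ofReal)).toReal with hℓ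
  set x : ℕ → ℝ := fun k => ℓ + 1 / (k + 1) with hxdef
  have hx : ∀ k, ℓ < x k := fun k => by simp only [hxdef]; linarith [Nat.one_div_pos_of_nat (α := ℝ) (n := k)]
  have hxlim : Tendsto x atTop (𝓝 ℓ) := by
    have := (tendsto_const_nhds (x := ℓ)).add (tendsto_one_div_add_atTop_nhds_zero_nat (𝕜 := ℝ))
    rwa [add_zero] at this
  choose g hg0 hg using fun k => A.exists_nonneg_resolvent_one hA (hx k)
  have hgne : ∀ k, g k ≠ 0 := fun k h => by
    have := hg k (Classical.arbitrary E)
    simp [h] at this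
  have hAc : Continuous fun v : E → ℝ => A *ᵥ v := by fun_prop
  -- The functions `g k` are resolvents at points decreasing to `ℓ`. A bounded subsequence would
  -- have a limit `w > 0` with `A w = ℓ w - 1`, pushing the spectral radius below `ℓ`. Hence they
  -- blow up, the term `1` is lost on normalising, and a limit point is an eigenvector.
  by_cases hb : ∃ C, ∃ᶠ k in atTop, ‖g k‖ ≤ C
  · exfalso
    obtain ⟨C, hC⟩ := hb
    obtain ⟨φ, hφ, hφC⟩ := extraction_of_frequently_atTop hC
    obtain ⟨w, -, ψ, hψ, hw⟩ := tendsto_subseq_of_bounded (Metric.isBounded_closedBall (x := 0) (r := C))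
      (x := fun k => g (φ k)) fun k => by simpa using hφC k
    have hxl : Tendsto (fun k => x (φ (ψ k))) atTop (𝓝 ℓ) :=
      hxlim.comp (hφ.tendsto_atTop.comp hψ.tendsto_atTop)
    have hwe : ∀ e, Tendsto (fun k => g (φ (ψ k)) e) atTop (𝓝 (w e)) := fun e =>
      (tendsto_pi_nhds.1 hw) e
    have hw1 : ∀ e, ℓ * w e = (A *ᵥ w) e + 1 := fun e => by
      refine tendsto_nhds_unique (hxl.mul (hwe e)) ?_
      simp only [hg]
      exact ((tendsto_pi_nhds.1 ((hAc.tendsto w).comp hw)) e).add_const 1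
    have hw0 : ∀ e, 0 ≤ w e := fun e => ge_of_tendsto' (hwe e) fun k => hg0 _ e
    have hAw : ∀ e, 0 ≤ (A *ᵥ w) e := fun e =>
      Finset.sum_nonneg fun e' _ => mul_nonneg (hA _ _) (hw0 _)
    have hwp : ∀ e, 0 < w e := fun e => (hw0 e).lt_of_ne' fun h => by
      have h1 := hw1 e
      have h2 := hAw e
      rw [h] at h1
      linarith
    obtain ⟨e₀, -, he₀⟩ := Finset.exists_max_image Finset.univ w Finset.univ_nonempty
    have h3 := A.spectralRadius_le_of_mulVec_le hA (ρ := ℓ - 1 / w e₀) hwp fun e => by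
      have h4 : w e / w e₀ ≤ 1 := (div_le_one (hwp e₀)).2 (he₀ e (Finset.mem_univ _))
      have h5 : (ℓ - 1 / w e₀) * w e = ℓ * w e - w e / w e₀ := by ring
      linarith [hw1 e]
    have h6 := hwp e₀
    have h7 : 0 < 1 / w e₀ := by positivity
    linarith
  · have hinf : Tendsto (fun k => ‖g k‖) atTop atTop := by
      rw [tendsto_atTop]
      intro C
      have : ¬ ∃ᶠ k in atTop, ‖g k‖ ≤ C := fun h => hb ⟨C, h⟩
      rw [not_frequently] at this
      exact this.mono fun k hk => (not_le.1 hk).le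
    have hun : ∀ k, ‖‖g k‖⁻¹ • g k‖ = 1 := fun k => norm_smul_inv_norm (hgne k)
    obtain ⟨w, hwm, ψ, hψ, hw⟩ := tendsto_subseq_of_bounded
      (Metric.isBounded_sphere (x := (0 : E → ℝ)) (r := 1))
      (x := fun k => ‖g k‖⁻¹ • g k) fun k => by simpa using hun k
    rw [Metric.isClosed_sphere.closure_eq, mem_sphere_zero_iff_norm] at hwm
    have hwe : ∀ e, Tendsto (fun k => ‖g (ψ k)‖⁻¹ * g (ψ k) e) atTop (𝓝 (w e)) := fun e =>
      (tendsto_pi_nhds.1 hw) e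
    refine ⟨w, fun e => ge_of_tendsto' (hwe e) fun k => ?_, ?_, ?_⟩
    · exact mul_nonneg (by positivity) (hg0 _ e)
    · rintro rfl
      simp at hwm
    · ext e
      have h1 : Tendsto (fun k => x (ψ k) * (‖g (ψ k)‖⁻¹ * g (ψ k) e)) atTop (𝓝 (ℓ * w e)) :=
        (hxlim.comp hψ.tendsto_atTop).mul (hwe e)
      have h2 : Tendsto (fun k => (A *ᵥ (‖g (ψ k)‖⁻¹ • g (ψ k))) e + ‖g (ψ k)‖⁻¹) atTop
          (𝓝 ((A *ᵥ w) e + 0)) :=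
        ((tendsto_pi_nhds.1 ((hAc.tendsto w).comp hw)) e).add
          (tendsto_inv_atTop_zero.comp (hinf.comp hψ.tendsto_atTop))
      rw [add_zero] at h2
      refine tendsto_nhds_unique h2 (h1.congr fun k => ?_)
      have := hg (ψ k) e
      rw [Matrix.mulVec_smul, Pi.smul_apply, smul_eq_mul, mul_left_comm, this]
      ring

end Perron

/-! ### Vertex sums and the Ihara-Bass relation -/

namespace InvGraph

section degrees

variable {V E K : Type*} [DecidableEq V] [Fintype E]

/-- The number of directed edges with tail `v`. -/
def deg (G : InvGraph V E) (v : V) : ℕ := (Finset.univ.filter fun e => G.t e = v).card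

/-- The sum of `g` over the directed edges with tail `v`. -/
def tailSum [AddCommMonoid K] (G : InvGraph V E) (g : E → K) (v : V) : K :=
  ∑ e with G.t e = v, g e

/-- The adjacency operator: the sum of `f` over the heads of the directed edges with tail `v`. -/
def adj [AddCommMonoid K] (G : InvGraph V E) (f : V → K) (v : V) : K :=
  G.tailSum (fun e => f (G.h e)) v

theorem h_ι (G : InvGraph V E) (e : E) : G.h (G.ι e) = G.t e := by
  rw [← G.t_ι, G.ι_ι]

theorem sum_ι [AddCommMonoid K] (G : InvGraph V E) (F : E → K) : ∑ e, F (G.ι e) = ∑ e, F e :=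
  Equiv.sum_comp (Function.Involutive.toPerm G.ι G.ι_ι) F

theorem sum_mul_tailSum [Fintype V] [CommSemiring K] (G : InvGraph V E) (f : V → K) (k : E → K) :
    ∑ v, f v * G.tailSum k v = ∑ e, f (G.t e) * k e := by
  rw [← Finset.sum_fiberwise Finset.univ G.t]
  refine Finset.sum_congr rfl fun v _ => ?_
  rw [tailSum, Finset.mul_sum]
  refine Finset.sum_congr rfl fun e he => ?_
  rw [(Finset.mem_filter.1 he).2]

theorem sum_tailSum [Fintype V] [AddCommMonoid K] (G : InvGraph V E) (k : E → K) :
    ∑ v, G.tailSum k v = ∑ e, k e :=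
  Finset.sum_fiberwise Finset.univ G.t k

theorem tailSum_const [Semiring K] (G : InvGraph V E) (c : K) (v : V) :
    G.tailSum (fun _ => c) v = G.deg v * c := by
  simp [tailSum, deg]

theorem sum_comp_t [Fintype V] [CommSemiring K] (G : InvGraph V E) (f : V → K) :
    ∑ e, f (G.t e) = ∑ v, G.deg v * f v := by
  have := G.sum_mul_tailSum f fun _ => 1
  simp only [mul_one, tailSum_const] at this
  rw [← this]
  exact Finset.sum_congr rfl fun v _ => mul_comm _ _

theorem sum_comp_h [Fintype V] [CommSemiring K] (G : InvGraph V E) (f : V → K) :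
    ∑ e, f (G.h e) = ∑ v, G.deg v * f v := by
  rw [← sum_comp_t, ← G.sum_ι]
  simp only [h_ι]

theorem sum_deg [Fintype V] (G : InvGraph V E) : ∑ v, G.deg v = Fintype.card E := by
  have := G.sum_tailSum fun _ => (1 : ℕ)
  simpa [tailSum_const] using this

theorem deg_le (G : InvGraph V E) (v : V) : G.deg v ≤ Fintype.card E :=
  Finset.card_filter_le _ _

variable [DecidableEq E]

/-- Exactly one directed edge leaving `G.h e` is excluded by the non-backtracking condition, namely
`G.ι e`. -/
theorem hashimoto_sum [Ring K] (G : InvGraph V E) (g : E → K) (e : E) :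
    ∑ e', (if G.h e = G.t e' ∧ G.ι e ≠ e' then (1 : K) else 0) * g e'
      = G.tailSum g (G.h e) - g (G.ι e) := by
  have h1 : G.ι e ∈ Finset.univ.filter fun e' => G.t e' = G.h e := by simp [G.t_ι]
  rw [tailSum, ← Finset.add_sum_erase _ _ h1, add_sub_cancel_left]
  simp only [ite_mul, one_mul, zero_mul, ← Finset.sum_filter]
  refine Finset.sum_congr ?_ fun _ _ => rfl
  ext e'
  simp only [Finset.mem_filter, Finset.mem_univ, true_and, Finset.mem_erase]
  tauto

theorem hashimoto_mulVec_apply (G : InvGraph V E) (g : E → ℂ) (e : E) :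
    G.hashimoto.mulVec g e = G.tailSum g (G.h e) - g (G.ι e) :=
  G.hashimoto_sum g e

/-- The reduction of the Hashimoto eigenvalue equation, with a constant inhomogeneity, to
directed edges and the vertex sums. -/
theorem edge_eq_of_hashimoto_eq [CommRing K] (G : InvGraph V E) {x c : K} {g : E → K}
    (hg : ∀ e, x * g e = G.tailSum g (G.h e) - g (G.ι e) + c) (e : E) :
    (x ^ 2 - 1) * g e = x * G.tailSum g (G.h e) - G.tailSum g (G.t e) + (x - 1) * c := by
  have h1 := hg e
  -- The equations at `e` and at its reverse together eliminate `g (G.ι e)`.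
  have h2 := hg (G.ι e)
  rw [G.ι_ι, G.h_ι] at h2
  linear_combination x * h1 - h2

/-- The Ihara-Bass relation for the vertex sums of a Hashimoto eigenfunction. -/
theorem vertex_eq_of_hashimoto_eq [CommRing K] (G : InvGraph V E) {x c : K} {g : E → K}
    (hg : ∀ e, x * g e = G.tailSum g (G.h e) - g (G.ι e) + c) (v : V) :
    (x ^ 2 - 1 + G.deg v) * G.tailSum g v
      = x * G.adj (G.tailSum g) v + (x - 1) * c * G.deg v := by
  have h1 : (x ^ 2 - 1) * G.tailSum g v = ∑ e with G.t e = v,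
      (x * G.tailSum g (G.h e) - G.tailSum g v + (x - 1) * c) := by
    rw [tailSum, Finset.mul_sum]
    refine Finset.sum_congr rfl fun e he => ?_
    rw [G.edge_eq_of_hashimoto_eq hg, (Finset.mem_filter.1 he).2]
    rfl
  rw [Finset.sum_add_distrib, Finset.sum_sub_distrib, ← Finset.mul_sum, Finset.sum_const,
    Finset.sum_const, nsmul_eq_mul, nsmul_eq_mul] at h1
  rw [adj, deg]
  change _ = x * (∑ e with G.t e = v, G.tailSum g (G.h e)) + _
  linear_combination h1

end degrees

/-! ### Perron functions of graphs -/

section perron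

open Matrix

variable {V E : Type*} [DecidableEq V] [Fintype E] [DecidableEq E]

/-- The Hashimoto matrix with real entries. -/
def hashimotoReal (G : InvGraph V E) : Matrix E E ℝ :=
  fun e₁ e₂ => if G.h e₁ = G.t e₂ ∧ G.ι e₁ ≠ e₂ then 1 else 0

theorem hashimotoReal_nonneg (G : InvGraph V E) (e e' : E) : 0 ≤ G.hashimotoReal e e' := by
  rw [hashimotoReal]
  split_ifs <;> simp

theorem hashimotoReal_map (G : InvGraph V E) :
    G.hashimotoReal.map Complex.ofReal = G.hashimoto := by
  ext e e'
  simp only [hashimotoReal, hashimoto, Matrix.map_apply]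
  split_ifs <;> simp

theorem mu1_nonneg (G : InvGraph V E) : 0 ≤ G.mu1 := ENNReal.toReal_nonneg

theorem norm_le_mu1 (G : InvGraph V E) {z : ℂ} {g : E → ℂ} (hg : g ≠ 0)
    (h : G.hashimoto *ᵥ g = z • g) : ‖z‖ ≤ G.mu1 := by
  refine G.hashimoto.norm_le_spectralRadius_toReal ?_
  rw [← Matrix.spectrum_toLin', ← Module.End.hasEigenvalue_iff_mem_spectrum]
  refine Module.End.hasEigenvalue_of_hasEigenvector (x := g) ⟨?_, hg⟩
  rw [Module.End.mem_eigenspace_iff, Matrix.toLin'_apply, h]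

theorem exists_perron_function [Nonempty E] (G : InvGraph V E) :
    ∃ g : E → ℝ, (∀ e, 0 ≤ g e) ∧ g ≠ 0 ∧
      ∀ e, G.mu1 * g e = G.tailSum g (G.h e) - g (G.ι e) := by
  obtain ⟨g, hg0, hg, h⟩ := G.hashimotoReal.exists_nonneg_eigenvector G.hashimotoReal_nonneg
  refine ⟨g, hg0, hg, fun e => ?_⟩
  rw [G.hashimotoReal_map] at h
  rw [← G.hashimoto_sum]
  exact (congrFun h e).symm

theorem exists_resolvent_function (G : InvGraph V E) {x : ℝ} (hx : G.mu1 < x) :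
    ∃ g : E → ℝ, (∀ e, 0 ≤ g e) ∧
      ∀ e, x * g e = G.tailSum g (G.h e) - g (G.ι e) + 1 := by
  obtain ⟨g, hg0, hg⟩ := G.hashimotoReal.exists_nonneg_resolvent_one G.hashimotoReal_nonneg
    (x := x) (by rwa [G.hashimotoReal_map])
  refine ⟨g, hg0, fun e => ?_⟩
  rw [← G.hashimoto_sum]
  exact hg e

theorem Connected.nonempty_edge_of_ne {G : InvGraph V E} (hG : G.Connected) {u v : V}
    (huv : u ≠ v) : ∃ e, G.t e = u := by
  rcases (hG.2 u v).cases_head with h | ⟨w, ⟨e, he, -⟩, -⟩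
  · exact absurd h huv
  · exact ⟨e, he⟩

/-- A connected graph whose Perron-Frobenius eigenvalue is at most `1` has at most twice as many
directed edges as vertices. -/
theorem card_edge_le_of_mu1_le_one [Fintype V] {G : InvGraph V E} (hG : G.Connected)
    (h1 : G.mu1 ≤ 1) : Fintype.card E ≤ 2 * Fintype.card V := by
  rcases isEmpty_or_nonempty E with hE | ⟨⟨e₀⟩⟩
  · simp
  have hout : ∀ v, ∃ e, G.t e = v := fun v => by
    by_cases h : v = G.t e₀
    · exact ⟨e₀, h.symm⟩
    · exact hG.nonempty_edge_of_ne h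
  -- Above the spectral radius the resolvent function is strictly positive, thanks to its constant
  -- term. A factor `x - 1` is cancelled at the end, so the bound is proved for `x > 1` and then
  -- passed to the limit `x → 1`.
  have key : ∀ x : ℝ, 1 < x → (Fintype.card E : ℝ) ≤ (x + 1) * Fintype.card V := by
    intro x hx
    obtain ⟨g, hg0, hg⟩ := G.exists_resolvent_function (h1.trans_lt hx)
    have hS0 : ∀ v, 0 ≤ G.tailSum g v := fun v => Finset.sum_nonneg fun e _ => hg0 e
    have hgpos : ∀ e, 0 < g e := fun e => by
      have h2 := G.edge_eq_of_hashimoto_eq hg e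
      have h3 := hg e
      refine (hg0 e).lt_of_ne' fun h0 => ?_
      have h4 : g (G.ι e) ≤ G.tailSum g (G.h e) := by
        rw [tailSum]
        exact Finset.single_le_sum (f := g) (fun e _ => hg0 e) (by simp [G.t_ι])
      rw [h0] at h3
      linarith
    have hS : ∀ v, 0 < G.tailSum g v := fun v => by
      obtain ⟨e, he⟩ := hout v
      exact Finset.sum_pos (fun e _ => hgpos e) ⟨e, by simp [he]⟩
    set S := G.tailSum g with hSdef
    -- The vertex sums form a positive supersolution of the Ihara-Bass equation; dividing by `S v`
    -- and summing leaves only counts of edges and vertices on the right.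
    have h5 : ∀ v, x * ((S v)⁻¹ * G.adj S v) ≤ x ^ 2 - 1 + G.deg v := fun v => by
      have h6 := G.vertex_eq_of_hashimoto_eq hg v
      have h7 : x * G.adj S v ≤ (x ^ 2 - 1 + G.deg v) * S v := by
        rw [h6]
        have : 0 ≤ (x - 1) * 1 * (G.deg v : ℝ) := mul_nonneg (by linarith) (by positivity)
        linarith
      rw [mul_left_comm, inv_mul_le_iff₀ (hS v)]
      linarith
    have h8 := Finset.sum_le_sum fun v (_ : v ∈ Finset.univ) => h5 v
    simp only [← Finset.mul_sum, adj, Finset.sum_add_distrib] at h8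
    rw [G.sum_mul_tailSum, ← Nat.cast_sum, G.sum_deg] at h8
    -- Pair each edge with its reverse and use `b / a + a / b ≥ 2`.
    have h9 : (Fintype.card E : ℝ) ≤ ∑ e, (S (G.t e))⁻¹ * S (G.h e) := by
      have h10 := G.sum_ι fun e => (S (G.t e))⁻¹ * S (G.h e)
      have h11 : ∑ _e : E, (2 : ℝ) ≤
          ∑ e, ((S (G.t e))⁻¹ * S (G.h e) + (S (G.t (G.ι e)))⁻¹ * S (G.h (G.ι e))) := by
        refine Finset.sum_le_sum fun e _ => ?_
        rw [G.t_ι, G.h_ι]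
        have ha := hS (G.t e)
        have hb := hS (G.h e)
        rw [inv_mul_eq_div, inv_mul_eq_div, div_add_div _ _ ha.ne' hb.ne', le_div_iff₀ (by positivity)]
        nlinarith [sq_nonneg (S (G.t e) - S (G.h e))]
      rw [Finset.sum_add_distrib, h10] at h11
      simp at h11
      linarith
    have h12 : x * Fintype.card E ≤ x * ∑ e, (S (G.t e))⁻¹ * S (G.h e) := by gcongr
    simp at h8
    have h13 : (x - 1) * Fintype.card E ≤ (x - 1) * ((x + 1) * Fintype.card V) := by
      linarith
    exact le_of_mul_le_mul_left h13 (by linarith)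
  have h14 : (Fintype.card E : ℝ) ≤ 2 * Fintype.card V := by
    have hc : Filter.Tendsto (fun x : ℝ => (x + 1) * (Fintype.card V : ℝ)) (nhdsWithin 1 (Set.Ioi 1))
        (nhds ((1 + 1) * Fintype.card V)) :=
      ((by fun_prop : Continuous fun x : ℝ => (x + 1) * (Fintype.card V : ℝ)).tendsto 1).mono_left
        nhdsWithin_le_nhds
    have := ge_of_tendsto hc (Filter.eventually_of_mem self_mem_nhdsWithin key)
    linarith
  exact_mod_cast h14

/-- Above `1`, the vertex sums of the Perron-Frobenius eigenfunction of a connected graph are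
positive. -/
theorem exists_pos_ground_state [Fintype V] {G : InvGraph V E} (hG : G.Connected)
    (h1 : 1 < G.mu1) :
    ∃ f : V → ℝ, (∀ v, 0 < f v) ∧
      ∀ v, (G.mu1 ^ 2 - 1 + G.deg v) * f v = G.mu1 * G.adj f v := by
  have hE : Nonempty E := by
    by_contra h
    rw [not_nonempty_iff] at h
    have : G.mu1 = 0 := by
      rw [mu1, Subsingleton.elim G.hashimoto 0]
      simp
    linarith
  obtain ⟨g, hg0, hgne, hg⟩ := G.exists_perron_function
  have hv := G.vertex_eq_of_hashimoto_eq (x := G.mu1) (g := g) (c := 0) (by simpa using hg)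
  simp only [mul_zero, zero_mul, add_zero] at hv
  have hS0 : ∀ v, 0 ≤ G.tailSum g v := fun v => Finset.sum_nonneg fun e _ => hg0 e
  refine ⟨G.tailSum g, fun v => ?_, hv⟩
  -- At a zero of the vertex sums the equation makes the sum over neighbours vanish. So positivity
  -- spreads backwards along walks, starting from the tail of an edge where `g` is positive.
  have hstep : ∀ a b, (∃ e, G.t e = a ∧ G.h e = b) → 0 < G.tailSum g b → 0 < G.tailSum g a := by
    rintro _ _ ⟨e, rfl, rfl⟩ hb
    refine (hS0 _).lt_of_ne' fun h0 => ?_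
    have h2 := hv (G.t e)
    rw [h0, mul_zero] at h2
    have h3 : 0 < G.adj (G.tailSum g) (G.t e) :=
      Finset.sum_pos' (fun _ _ => hS0 _) ⟨e, by simp, hb⟩
    have : 0 < G.mu1 * G.adj (G.tailSum g) (G.t e) := by positivity
    linarith
  obtain ⟨e, he⟩ := Function.ne_iff.1 hgne
  have hpos : 0 < G.tailSum g (G.t e) :=
    Finset.sum_pos' (fun _ _ => hg0 _) ⟨e, by simp, (hg0 e).lt_of_ne' he⟩
  have hw := hG.2 v (G.t e)
  induction hw using Relation.ReflTransGen.head_induction_on with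
  | refl => exact hpos
  | head h _ ih => exact hstep _ _ h ih

end perron

end InvGraph

/-! ### Co-area and Cheeger inequalities -/

namespace InvGraph

section cheeger

variable {V E : Type*} [Fintype V] [DecidableEq V] [Fintype E]

/-- A graph in which every nonempty set `U` of at most half of the vertices has at least
`γ * #U` neighbours outside `U`. -/
def IsMagnifier (γ : ℝ) (G : InvGraph V E) : Prop :=
  ∀ U : Finset V, U.Nonempty → (U.card : ℝ) ≤ (Fintype.card V : ℝ) / 2 →
    γ * (U.card : ℝ) ≤ ((G.nbhd U \ U).card : ℝ)

theorem mem_nbhd {G : InvGraph V E} {U : Finset V} {v : V} :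
    v ∈ G.nbhd U ↔ ∃ e, G.t e ∈ U ∧ G.h e = v := by
  simp [nbhd]

theorem card_nbhd_sdiff_le (G : InvGraph V E) (U : Finset V) :
    (G.nbhd U \ U).card ≤ (Finset.univ.filter fun e => G.t e ∈ U ∧ G.h e ∉ U).card := by
  refine (Finset.card_le_card fun v hv => ?_).trans (Finset.card_image_le (f := G.h))
  rw [Finset.mem_sdiff, mem_nbhd] at hv
  obtain ⟨⟨e, he, rfl⟩, hv⟩ := hv
  exact Finset.mem_image.2 ⟨e, by simp [he, hv], rfl⟩

/-- The co-area inequality for functions supported on at most half of the vertices. -/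
theorem IsMagnifier.mul_sum_le {γ : ℝ} {G : InvGraph V E} (hG : G.IsMagnifier γ) (F : V → ℝ)
    (hF : ∀ v, 0 ≤ F v)
    (hs : ((Finset.univ.filter fun v => F v ≠ 0).card : ℝ) ≤ (Fintype.card V : ℝ) / 2) :
    γ * ∑ v, F v ≤ ∑ e, max (F (G.t e) - F (G.h e)) 0 := by
  -- Peel off the lowest positive level: `F` is `F'` plus `a` times the indicator of its support
  -- `U`. Both sides split accordingly, and the indicator part is the magnifier property of `U`.
  induction hk : (Finset.univ.filter fun v => F v ≠ 0).card using Nat.strong_induction_on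
    generalizing F with
  | _ k ih =>
    set U := Finset.univ.filter fun v => F v ≠ 0 with hU
    have hmem : ∀ v, v ∈ U ↔ F v ≠ 0 := fun v => by simp [hU]
    have hnot : ∀ v, v ∉ U → F v = 0 := fun v hv => by
      by_contra h
      exact hv ((hmem v).2 h)
    rcases U.eq_empty_or_nonempty with h0 | hne
    · have hF0 : ∀ v, F v = 0 := fun v => hnot v (by simp [h0])
      simp [hF0]
    · obtain ⟨v₀, hv₀, hmin⟩ := Finset.exists_min_image U F hne
      set a := F v₀ with ha
      have ha0 : 0 < a := (hF v₀).lt_of_ne' ((hmem v₀).1 hv₀)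
      set F' : V → ℝ := fun v => if v ∈ U then F v - a else 0 with hF'
      have hF'0 : ∀ v, 0 ≤ F' v := fun v => by
        simp only [hF']
        split_ifs with h
        · linarith [hmin v h]
        · exact le_rfl
      have hss : (Finset.univ.filter fun v => F' v ≠ 0) ⊂ U := by
        refine Finset.ssubset_iff_subset_ne.2 ⟨fun v hv => ?_, fun h => ?_⟩
        · by_contra hvU
          simp [hF', hvU] at hv
        · rw [← h] at hv₀
          simp [hF', ha] at hv₀
      have hcard := Finset.card_lt_card hss
      have hcard' : ((Finset.univ.filter fun v => F' v ≠ 0).card : ℝ) ≤ U.card := by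
        exact_mod_cast hcard.le
      have h1 := ih _ (hk ▸ hcard) F' hF'0 (hcard'.trans hs) rfl
      have h2 : ∑ v, F v = ∑ v, F' v + a * U.card := by
        have : ∀ v, F v = F' v + if v ∈ U then a else 0 := fun v => by
          simp only [hF']
          split_ifs with h
          · ring
          · simp [hnot v h]
        rw [Finset.sum_congr rfl fun v _ => this v, Finset.sum_add_distrib]
        simp [mul_comm]
      have h3 : ∑ e, max (F (G.t e) - F (G.h e)) 0 = ∑ e, max (F' (G.t e) - F' (G.h e)) 0 +
          a * (Finset.univ.filter fun e => G.t e ∈ U ∧ G.h e ∉ U).card := by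
        have : ∀ e, max (F (G.t e) - F (G.h e)) 0 = max (F' (G.t e) - F' (G.h e)) 0 +
            if G.t e ∈ U ∧ G.h e ∉ U then a else 0 := fun e => by
          by_cases ht : G.t e ∈ U <;> by_cases hh : G.h e ∈ U
          · simp [hF', ht, hh]
          · have h4 := hmin _ ht
            simp only [hF', ht, hh, hnot _ hh, if_true, if_false, not_false_eq_true, and_self,
              sub_zero]
            rw [max_eq_left (by linarith), max_eq_left (by linarith)]
            ring
          · have h4 := hmin _ hh
            simp only [hF', ht, hh, hnot _ ht, if_true, if_false, false_and, add_zero, zero_sub]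
            rw [max_eq_right (by linarith), max_eq_right (by linarith)]
          · simp [hF', ht, hh, hnot _ ht, hnot _ hh]
        rw [Finset.sum_congr rfl fun e _ => this e, Finset.sum_add_distrib, ← Finset.sum_filter,
          Finset.sum_const, nsmul_eq_mul, mul_comm a]
      have h5 : γ * U.card ≤ (Finset.univ.filter fun e => G.t e ∈ U ∧ G.h e ∉ U).card :=
        (hG U hne hs).trans (by exact_mod_cast G.card_nbhd_sdiff_le U)
      have h6 := mul_le_mul_of_nonneg_left h5 ha0.le
      rw [h2, h3]
      linarith

/-- Apply the co-area inequality to `p²`, factor the difference of squares, and use Cauchy-Schwarz;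
the factor with `p (G.t e) + p (G.h e)` costs `4 * Δ * ∑ p²`, one power of which cancels. -/
theorem IsMagnifier.sq_mul_sum_sq_le_of_support {γ : ℝ} (hγ : 0 ≤ γ) {G : InvGraph V E}
    (hG : G.IsMagnifier γ) {Δ : ℕ} (hΔ : ∀ v, G.deg v ≤ Δ) (p : V → ℝ) (hp : ∀ v, 0 ≤ p v)
    (hs : ((Finset.univ.filter fun v => p v ≠ 0).card : ℝ) ≤ (Fintype.card V : ℝ) / 2) :
    γ ^ 2 * ∑ v, p v ^ 2 ≤ 4 * Δ * ∑ e, (p (G.t e) - p (G.h e)) ^ 2 := by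
  have h1 := hG.mul_sum_le (fun v => p v ^ 2) (fun v => sq_nonneg _) (by simpa using hs)
  set X := ∑ v, p v ^ 2 with hX
  have hX0 : 0 ≤ X := Finset.sum_nonneg fun v _ => sq_nonneg _
  set Y := ∑ e, (p (G.t e) - p (G.h e)) ^ 2 with hY
  have hY0 : 0 ≤ Y := Finset.sum_nonneg fun v _ => sq_nonneg _
  have h2 : ∑ e, max (p (G.t e) ^ 2 - p (G.h e) ^ 2) 0 ≤
      ∑ e, |p (G.t e) - p (G.h e)| * (p (G.t e) + p (G.h e)) := by
    refine Finset.sum_le_sum fun e _ => max_le ?_ ?_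
    · rw [sq_sub_sq, mul_comm]
      exact mul_le_mul_of_nonneg_right (le_abs_self _) (add_nonneg (hp _) (hp _))
    · exact mul_nonneg (abs_nonneg _) (add_nonneg (hp _) (hp _))
  have h3 := Finset.sum_mul_sq_le_sq_mul_sq Finset.univ (fun e => |p (G.t e) - p (G.h e)|)
    fun e => p (G.t e) + p (G.h e)
  simp only [sq_abs] at h3
  have h4 : ∑ e, (p (G.t e) + p (G.h e)) ^ 2 ≤ 4 * Δ * X := by
    calc ∑ e, (p (G.t e) + p (G.h e)) ^ 2 ≤ ∑ e, (2 * p (G.t e) ^ 2 + 2 * p (G.h e) ^ 2) :=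
          Finset.sum_le_sum fun e _ => by nlinarith [sq_nonneg (p (G.t e) - p (G.h e))]
      _ = 4 * ∑ v, G.deg v * p v ^ 2 := by
        rw [Finset.sum_add_distrib, ← Finset.mul_sum, ← Finset.mul_sum,
          G.sum_comp_t fun v => p v ^ 2, G.sum_comp_h fun v => p v ^ 2]
        ring
      _ ≤ 4 * ∑ v, Δ * p v ^ 2 := by
        gcongr with v
        exact_mod_cast hΔ v
      _ = 4 * Δ * X := by rw [← Finset.mul_sum]; ring
  rcases hX0.eq_or_lt with h0 | hXpos
  · rw [← h0]
    have : (0 : ℝ) ≤ 4 * Δ * Y := by positivity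
    simpa using this
  · have h5 : (γ * X) ^ 2 ≤ Y * (4 * Δ * X) :=
      (pow_le_pow_left₀ (by positivity) (h1.trans h2) 2).trans
        (h3.trans (mul_le_mul_of_nonneg_left h4 hY0))
    have h6 : (γ ^ 2 * X) * X ≤ (4 * Δ * Y) * X := by linarith
    exact le_of_mul_le_mul_right h6 hXpos

/-- Take the smallest value exceeded by at most half of the vertices. Were more than half strictly
below it, the next lower value would also qualify. -/
theorem exists_median [Nonempty V] (h : V → ℝ) :
    ∃ m : ℝ, 2 * (Finset.univ.filter fun v => m < h v).card ≤ Fintype.card V ∧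
      2 * (Finset.univ.filter fun v => h v < m).card ≤ Fintype.card V := by
  obtain ⟨w, -, hw⟩ := Finset.exists_max_image Finset.univ h Finset.univ_nonempty
  have hw' : (Finset.univ.filter fun v => h w < h v) = ∅ :=
    Finset.filter_eq_empty_iff.2 fun v _ => not_lt.2 (hw v (Finset.mem_univ v))
  obtain ⟨v₀, hv₀, hmin⟩ := Finset.exists_min_image
    (Finset.univ.filter fun x => 2 * (Finset.univ.filter fun v => h x < h v).card ≤ Fintype.card V)
    h ⟨w, by simp [hw']⟩
  refine ⟨h v₀, (Finset.mem_filter.1 hv₀).2, ?_⟩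
  by_contra! hlt
  have hne : (Finset.univ.filter fun v => h v < h v₀).Nonempty := by
    rw [← Finset.card_pos]
    omega
  obtain ⟨v₁, hv₁, hmax⟩ := Finset.exists_max_image _ h hne
  have hv₁' : h v₁ < h v₀ := (Finset.mem_filter.1 hv₁).2
  have hsub : (Finset.univ.filter fun v => h v₁ < h v) ⊆
      Finset.univ \ Finset.univ.filter fun v => h v < h v₀ := fun v hv => by
    have h1 := (Finset.mem_filter.1 hv).2
    refine Finset.mem_sdiff.2 ⟨Finset.mem_univ v, fun h2 => ?_⟩
    exact absurd (hmax v h2) (not_le.2 h1)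
  have hcard := Finset.card_le_card hsub
  rw [Finset.card_sdiff_of_subset (Finset.subset_univ _), Finset.card_univ] at hcard
  have := hmin v₁ (Finset.mem_filter.2 ⟨Finset.mem_univ _, by omega⟩)
  linarith

/-- **Cheeger's inequality** for functions with sum zero. -/
theorem IsMagnifier.sq_mul_sum_sq_le {γ : ℝ} (hγ : 0 ≤ γ) {G : InvGraph V E}
    (hG : G.IsMagnifier γ) {Δ : ℕ} (hΔ : ∀ v, G.deg v ≤ Δ) (h : V → ℝ) (hh : ∑ v, h v = 0) :
    γ ^ 2 * ∑ v, h v ^ 2 ≤ 4 * Δ * ∑ e, (h (G.t e) - h (G.h e)) ^ 2 := by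
  rcases isEmpty_or_nonempty V with hV | hV
  · simp only [Finset.univ_eq_empty, Finset.sum_empty, mul_zero]
    exact mul_nonneg (by positivity) (Finset.sum_nonneg fun _ _ => sq_nonneg _)
  -- The positive and negative parts of `h - m` are each supported on at most half of the vertices,
  -- so the previous bound applies to both.
  obtain ⟨m, hm1, hm2⟩ := exists_median h
  have hcast : ∀ {k : ℕ}, 2 * k ≤ Fintype.card V → (k : ℝ) ≤ (Fintype.card V : ℝ) / 2 := by
    intro k hk
    rw [le_div_iff₀ two_pos, mul_comm]
    exact_mod_cast hk
  have h1 := hG.sq_mul_sum_sq_le_of_support hγ hΔ (fun v => max (h v - m) 0)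
    (fun v => le_max_right _ _) (by simpa using hcast hm1)
  have h2 := hG.sq_mul_sum_sq_le_of_support hγ hΔ (fun v => max (m - h v) 0)
    (fun v => le_max_right _ _) (by simpa using hcast hm2)
  -- Since `h` has sum zero, shifting it by a constant can only increase its sum of squares.
  have h3 : ∑ v, h v ^ 2 ≤ ∑ v, max (h v - m) 0 ^ 2 + ∑ v, max (m - h v) 0 ^ 2 := by
    rw [← Finset.sum_add_distrib]
    have h4 : ∀ v, max (h v - m) 0 ^ 2 + max (m - h v) 0 ^ 2 = h v ^ 2 - 2 * m * h v + m ^ 2 := by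
      intro v
      rcases le_total (h v) m with hv | hv
      · rw [max_eq_right (by linarith), max_eq_left (by linarith)]
        ring
      · rw [max_eq_left (by linarith), max_eq_right (by linarith)]
        ring
    rw [Finset.sum_congr rfl fun v _ => h4 v, Finset.sum_add_distrib, Finset.sum_sub_distrib,
      ← Finset.mul_sum, hh]
    have : 0 ≤ ∑ _v : V, m ^ 2 := Finset.sum_nonneg fun _ _ => sq_nonneg _
    linarith
  have h5 : ∑ e, (max (h (G.t e) - m) 0 - max (h (G.h e) - m) 0) ^ 2 +
      ∑ e, (max (m - h (G.t e)) 0 - max (m - h (G.h e)) 0) ^ 2 ≤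
      ∑ e, (h (G.t e) - h (G.h e)) ^ 2 := by
    rw [← Finset.sum_add_distrib]
    refine Finset.sum_le_sum fun e _ => ?_
    generalize h (G.t e) = a
    generalize h (G.h e) = b
    rcases le_total a m with ha | ha <;> rcases le_total b m with hb | hb
    · rw [max_eq_right (by linarith), max_eq_right (by linarith), max_eq_left (by linarith),
        max_eq_left (by linarith)]
      apply le_of_eq
      ring
    · rw [max_eq_right (by linarith), max_eq_left (by linarith), max_eq_left (by linarith),
        max_eq_right (by linarith)]
      nlinarith [mul_nonneg (sub_nonneg.2 ha) (sub_nonneg.2 hb)]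
    · rw [max_eq_left (by linarith), max_eq_right (by linarith), max_eq_right (by linarith),
        max_eq_left (by linarith)]
      nlinarith [mul_nonneg (sub_nonneg.2 ha) (sub_nonneg.2 hb)]
    · rw [max_eq_left (by linarith), max_eq_left (by linarith), max_eq_right (by linarith),
        max_eq_right (by linarith)]
      apply le_of_eq
      ring
  calc γ ^ 2 * ∑ v, h v ^ 2
      ≤ γ ^ 2 * (∑ v, max (h v - m) 0 ^ 2 + ∑ v, max (m - h v) 0 ^ 2) := by gcongr
    _ ≤ 4 * Δ * (∑ e, (max (h (G.t e) - m) 0 - max (h (G.h e) - m) 0) ^ 2 +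
      ∑ e, (max (m - h (G.t e)) 0 - max (m - h (G.h e)) 0) ^ 2) := by
        rw [mul_add, mul_add]
        exact add_le_add h1 h2
    _ ≤ _ := by gcongr

end cheeger

end InvGraph

/-! ### Balanced cuts of graphs with few edges -/

namespace InvGraph

section tree

variable {V E : Type*} [Fintype V] [DecidableEq V] [Fintype E]

/-- A connected graph has, for every root, a height function that decreases along an edge leaving
each other vertex. -/
theorem Connected.exists_height {G : InvGraph V E} (hG : G.Connected) (root : V) :
    ∃ D : V → ℕ, ∀ v, v ≠ root → ∃ e, G.t e = v ∧ D (G.h e) < D v := by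
  let Γ : SimpleGraph V := SimpleGraph.fromRel fun a b => ∃ e, G.t e = a ∧ G.h e = b
  have hadj : ∀ {a b}, Γ.Adj a b → ∃ e, G.t e = a ∧ G.h e = b := by
    rintro a b ⟨-, h | ⟨e, rfl, rfl⟩⟩
    · exact h
    · exact ⟨G.ι e, G.t_ι e, G.h_ι e⟩
  have hreach : ∀ u v, Γ.Reachable u v := fun u v => by
    have := hG.2 u v
    induction this with
    | refl => exact SimpleGraph.Reachable.refl u
    | @tail b c _ h ih =>
      by_cases hbc : b = c
      · exact hbc ▸ ih
      · exact ih.trans (SimpleGraph.Adj.reachable ⟨hbc, Or.inl h⟩)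
  refine ⟨fun v => Γ.dist v root, fun v hv => ?_⟩
  obtain ⟨p, hp⟩ := (hreach v root).exists_walk_length_eq_dist
  cases p with
  | nil => exact absurd rfl hv
  | cons h q =>
    obtain ⟨e, he1, he2⟩ := hadj h
    refine ⟨e, he1, ?_⟩
    beta_reduce
    rw [he2, ← hp, SimpleGraph.Walk.length_cons]
    exact Nat.lt_succ_of_le (SimpleGraph.dist_le q)

open Classical in
/-- A connected graph whose number of directed edges is at most twice the number of vertices can be
cut into two large pieces at three vertices. -/
theorem Connected.exists_balanced_cut {G : InvGraph V E} (hG : G.Connected)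
    (hE : Fintype.card E ≤ 2 * Fintype.card V) {Δ : ℕ} (hΔ : ∀ v, G.deg v ≤ Δ)
    (hV : 2 ≤ Fintype.card V) :
    ∃ U : Finset V, U.Nonempty ∧ 2 * U.card ≤ Fintype.card V ∧
      Fintype.card V ≤ 1 + 2 * Δ * U.card ∧ (G.nbhd U \ U).card ≤ 3 := by
  obtain ⟨root⟩ := hG.1
  obtain ⟨D, hD⟩ := hG.exists_height root
  have hE' : Nonempty E := by
    obtain ⟨v, hv⟩ := Fintype.exists_ne_of_one_lt_card hV root
    exact ⟨(hD v hv).choose⟩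
  -- The edges `ε w` with `w ≠ root` form a spanning tree, each pointing from `w` to its parent; `ε
  -- root` is a dummy. Below, `r w x` says that `x` is the parent of `w`, and `T v` is the subtree
  -- of descendants of `v`.
  have hD' : ∀ v, ∃ e, v ≠ root → G.t e = v ∧ D (G.h e) < D v := fun v => by
    by_cases hv : v = root
    · exact ⟨Classical.arbitrary E, fun h => absurd hv h⟩
    · exact (hD v hv).imp fun e he _ => he
  choose ε hε using hD'
  set r : V → V → Prop := fun w x => w ≠ root ∧ G.h (ε w) = x with hr
  set T : V → Finset V := fun v => Finset.univ.filter fun w => Relation.ReflTransGen r w v with hT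
  have hmemT : ∀ v w, w ∈ T v ↔ Relation.ReflTransGen r w v := fun v w => by simp [hT]
  have hroot : T root = Finset.univ := by
    refine Finset.eq_univ_of_forall fun w => (hmemT _ _).2 ?_
    induction hk : D w using Nat.strong_induction_on generalizing w with
    | _ k ih =>
      by_cases hw : w = root
      · rw [hw]
      · exact Relation.ReflTransGen.head ⟨hw, rfl⟩ (ih _ (hk ▸ (hε w hw).2) _ rfl)
  -- Among the vertices whose subtree exceeds half of the graph, take one of greatest height. Its
  -- children then have subtrees of at most half, and the largest of these, among at most `Δ`, is
  -- the required piece.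
  obtain ⟨v, hv, hvmax⟩ := Finset.exists_max_image
    (Finset.univ.filter fun v => Fintype.card V < 2 * (T v).card) D
    ⟨root, by simp [hroot, Finset.card_univ]; omega⟩
  have hvlt : Fintype.card V < 2 * (T v).card := (Finset.mem_filter.1 hv).2
  set ch := Finset.univ.filter fun c => r c v with hch
  have hmemch : ∀ c, c ∈ ch ↔ r c v := fun c => by simp [hch]
  have hTv : (T v).card ≤ 1 + ∑ c ∈ ch, (T c).card := by
    have hsub : T v ⊆ {v} ∪ ch.biUnion T := fun w hw => by
      rcases ((hmemT v w).1 hw).cases_tail with h | ⟨c, hwc, hcv⟩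
      · simp [h]
      · exact Finset.mem_union_right _
          (Finset.mem_biUnion.2 ⟨c, (hmemch c).2 hcv, (hmemT c w).2 hwc⟩)
    refine (Finset.card_le_card hsub).trans ((Finset.card_union_le _ _).trans ?_)
    rw [Finset.card_singleton]
    exact Nat.add_le_add_left Finset.card_biUnion_le 1
  have hchne : ch.Nonempty := by
    rw [Finset.nonempty_iff_ne_empty]
    intro h
    rw [h, Finset.sum_empty] at hTv
    omega
  have hchcard : ch.card ≤ Δ := by
    refine le_trans ?_ (hΔ v)
    refine Finset.card_le_card_of_injOn (fun c => G.ι (ε c)) (fun c hc => ?_) fun c hc c' hc' h => ?_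
    · have := ((hmemch c).1 hc).2
      simp [G.t_ι, this]
    · have h1 := (hε c ((hmemch c).1 hc).1).1
      have h2 := (hε c' ((hmemch c').1 hc').1).1
      have h3 : ε c = ε c' := by
        have := congrArg G.ι h
        simpa [G.ι_ι] using this
      rw [← h1, ← h2, h3]
  obtain ⟨c, hc, hcmax⟩ := Finset.exists_max_image ch (fun c => (T c).card) hchne
  have hrc := (hmemch c).1 hc
  have hsum : ∑ c ∈ ch, (T c).card ≤ Δ * (T c).card := by
    refine (Finset.sum_le_card_nsmul ch _ _ hcmax).trans ?_
    rw [smul_eq_mul]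
    exact Nat.mul_le_mul_right _ hchcard
  have hTc : 2 * (T c).card ≤ Fintype.card V := by
    by_contra! h
    have h1 := hvmax c (by simp [h])
    have h2 := (hε c hrc.1).2
    rw [hrc.2] at h2
    omega
  refine ⟨T c, ⟨c, (hmemT c c).2 Relation.ReflTransGen.refl⟩, hTc, ?_, ?_⟩
  · rw [mul_assoc]
    omega
  -- The tree edges in both directions number `2 * (#V - 1)`, so at most two directed edges lie
  -- outside `F`. A tree edge leaves `T c` only towards the parent `v`; this gives `1 + 2` boundary
  -- vertices.
  set F := (Finset.univ.erase root).image ε ∪ (Finset.univ.erase root).image fun w => G.ι (ε w)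
    with hF
  have hεinj : Set.InjOn ε (Finset.univ.erase root : Finset V) := fun a ha b hb hab => by
    have ha' : a ≠ root := by simpa using ha
    have hb' : b ≠ root := by simpa using hb
    rw [← (hε a ha').1, ← (hε b hb').1, hab]
  have hFcard : F.card = 2 * (Fintype.card V - 1) := by
    rw [hF, Finset.card_union_of_disjoint, Finset.card_image_of_injOn hεinj,
      Finset.card_image_of_injOn fun a ha b hb hab => hεinj ha hb ?_,
      Finset.card_erase_of_mem (Finset.mem_univ _), Finset.card_univ, two_mul]
    · have := congrArg G.ι hab
      simpa [G.ι_ι] using this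
    · rw [Finset.disjoint_left]
      intro e he he'
      obtain ⟨a, ha, rfl⟩ := Finset.mem_image.1 he
      obtain ⟨b, hb, hab⟩ := Finset.mem_image.1 he'
      have ha' := hε a (Finset.ne_of_mem_erase ha)
      have hb' := hε b (Finset.ne_of_mem_erase hb)
      have h1 : G.h (ε b) = a := by rw [← G.t_ι, hab, ha'.1]
      have h2 : G.h (ε a) = b := by rw [← hab, G.h_ι, hb'.1]
      have := ha'.2
      have := hb'.2
      rw [h1] at *
      rw [h2] at *
      omega
  have hbd : G.nbhd (T c) \ T c ⊆ {v} ∪ (Finset.univ \ F).image G.h := fun y hy => by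
    rw [Finset.mem_sdiff, mem_nbhd] at hy
    obtain ⟨⟨e, he, rfl⟩, hy⟩ := hy
    by_cases heF : e ∈ F
    · refine Finset.mem_union_left _ ?_
      rw [hmemT] at he hy
      rcases Finset.mem_union.1 heF with h | h
      · obtain ⟨w, hw, rfl⟩ := Finset.mem_image.1 h
        have hw' := Finset.ne_of_mem_erase hw
        rw [(hε w hw').1] at he
        rcases he.cases_head with rfl | ⟨x, ⟨-, hx⟩, hxc⟩
        · exact Finset.mem_singleton.2 hrc.2
        · exact absurd (hx ▸ hxc) hy
      · obtain ⟨w, hw, rfl⟩ := Finset.mem_image.1 h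
        have hw' := Finset.ne_of_mem_erase hw
        rw [G.t_ι] at he
        rw [G.h_ι, (hε w hw').1] at hy
        exact absurd (Relation.ReflTransGen.head ⟨hw', rfl⟩ he) hy
    · exact Finset.mem_union_right _ (Finset.mem_image.2 ⟨e, by simp [heF], rfl⟩)
  refine (Finset.card_le_card hbd).trans ((Finset.card_union_le _ _).trans ?_)
  have h1 : ((Finset.univ \ F).image G.h).card ≤ Fintype.card E - F.card := by
    refine Finset.card_image_le.trans ?_
    rw [Finset.card_sdiff_of_subset (Finset.subset_univ _), Finset.card_univ]
  rw [Finset.card_singleton]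
  omega

/-- A magnifier is connected. -/
theorem IsMagnifier.connected [Nonempty V] {γ : ℝ} (hγ : 0 < γ) {G : InvGraph V E}
    (hG : G.IsMagnifier γ) : G.Connected := by
  classical
  set r : V → V → Prop := fun a b => ∃ e, G.t e = a ∧ G.h e = b with hr
  have hsymm : ∀ a b, r a b → r b a := by
    rintro _ _ ⟨e, rfl, rfl⟩
    exact ⟨G.ι e, G.t_ι e, G.h_ι e⟩
  -- A closed nonempty set contains more than half of the vertices, which cannot hold both for a
  -- component and for its complement.
  have hcl : ∀ U : Finset V, U.Nonempty → (∀ a b, a ∈ U → r a b → b ∈ U) →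
      Fintype.card V < 2 * U.card := by
    intro U hU hclosed
    by_contra! hle
    have h1 := hG U hU (by
      rw [le_div_iff₀ two_pos, mul_comm]
      exact_mod_cast hle)
    have h2 : G.nbhd U \ U = ∅ := by
      rw [Finset.sdiff_eq_empty_iff_subset]
      intro y hy
      obtain ⟨e, he, rfl⟩ := mem_nbhd.1 hy
      exact hclosed _ _ he ⟨e, rfl, rfl⟩
    rw [h2, Finset.card_empty, Nat.cast_zero] at h1
    have h3 : 0 < γ * U.card := mul_pos hγ (by exact_mod_cast hU.card_pos)
    linarith
  refine ⟨inferInstance, fun u v => ?_⟩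
  set U := Finset.univ.filter fun w => Relation.ReflTransGen r u w with hU
  by_contra hv
  have h1 := hcl U ⟨u, by simp [hU, Relation.ReflTransGen.refl]⟩ fun a b ha hab => by
    simp only [hU, Finset.mem_filter, Finset.mem_univ, true_and] at ha ⊢
    exact ha.tail hab
  have h2 := hcl Uᶜ ⟨v, by simpa [hU] using hv⟩ fun a b ha hab => by
    simp only [hU, Finset.mem_compl, Finset.mem_filter, Finset.mem_univ, true_and] at ha ⊢
    exact fun hb => ha (hb.tail (hsymm _ _ hab))
  rw [Finset.card_compl] at h2
  omega

/-- The balanced cut has at most three boundary vertices, so expansion bounds the size of the piece,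
which in turn controls the whole graph. -/
theorem IsMagnifier.card_le_of_card_edge_le [Nonempty V] {γ : ℝ} (hγ : 0 < γ) {G : InvGraph V E}
    (hG : G.IsMagnifier γ) (hE : Fintype.card E ≤ 2 * Fintype.card V) {Δ : ℕ}
    (hΔ : ∀ v, G.deg v ≤ Δ) : (Fintype.card V : ℝ) ≤ 1 + 6 * Δ / γ := by
  by_cases hV : 2 ≤ Fintype.card V
  · obtain ⟨U, hU, h1, h2, h3⟩ := (hG.connected hγ).exists_balanced_cut hE hΔ hV
    have h4 := hG U hU (by
      rw [le_div_iff₀ two_pos, mul_comm]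
      exact_mod_cast h1)
    have h5 : ((G.nbhd U \ U).card : ℝ) ≤ 3 := by exact_mod_cast h3
    have h6 : (Fintype.card V : ℝ) ≤ 1 + 2 * Δ * U.card := by exact_mod_cast h2
    have h7 : (U.card : ℝ) ≤ 3 / γ := by
      rw [le_div_iff₀ hγ]
      linarith
    calc (Fintype.card V : ℝ) ≤ 1 + 2 * Δ * U.card := h6
      _ ≤ 1 + 2 * Δ * (3 / γ) := by gcongr
      _ = 1 + 6 * Δ / γ := by ring
  · have h1 : (Fintype.card V : ℝ) ≤ 1 := by exact_mod_cast (by omega : Fintype.card V ≤ 1)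
    have h2 : 0 ≤ 6 * Δ / γ := by positivity
    linarith

end tree

end InvGraph

/-! ### Ground-state transform and the gap estimate -/

namespace InvGraph

section gap

variable {V E : Type*} [Fintype V] [DecidableEq V] [Fintype E]

open ComplexConjugate in
/-- The ground-state representation of the quadratic form of the Ihara-Bass operator. -/
theorem sum_ground_state_eq (G : InvGraph V E) (f : V → ℝ) (h : V → ℂ) :
    ∑ e, f (G.t e) * f (G.h e) * Complex.normSq (h (G.t e) - h (G.h e)) =
      2 * ∑ v, (f v * Complex.normSq (h v) * G.adj f v -
        (conj (f v * h v) * G.adj (fun w => (f w : ℂ) * h w) v).re) := by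
  have h1 : ∑ v, f v * Complex.normSq (h v) * G.adj f v =
      ∑ e, f (G.t e) * Complex.normSq (h (G.t e)) * f (G.h e) :=
    G.sum_mul_tailSum (fun v => f v * Complex.normSq (h v)) _
  have h2 : ∑ v, conj ((f v : ℂ) * h v) * G.adj (fun w => (f w : ℂ) * h w) v =
      ∑ e, conj ((f (G.t e) : ℂ) * h (G.t e)) * (f (G.h e) * h (G.h e)) :=
    G.sum_mul_tailSum (fun v => conj ((f v : ℂ) * h v)) _
  have h3 : ∑ e, f (G.h e) * Complex.normSq (h (G.h e)) * f (G.t e) =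
      ∑ e, f (G.t e) * Complex.normSq (h (G.t e)) * f (G.h e) := by
    rw [← G.sum_ι]
    simp only [G.t_ι, G.h_ι]
  have h4 := congrArg Complex.re h2
  rw [Complex.re_sum, Complex.re_sum] at h4
  rw [Finset.sum_sub_distrib, h1, h4, two_mul]
  -- One of the two copies is reversed, so that the squares at the head and at the tail both appear.
  nth_rewrite 1 [← h3]
  rw [← Finset.sum_sub_distrib, ← Finset.sum_sub_distrib, ← Finset.sum_add_distrib]
  refine Finset.sum_congr rfl fun e _ => ?_
  simp only [Complex.normSq_apply, Complex.sub_re, Complex.sub_im, Complex.mul_re, Complex.mul_im,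
    Complex.conj_re, Complex.conj_im, Complex.ofReal_re, Complex.ofReal_im]
  ring

/-- Cheeger's inequality for complex functions with sum zero. -/
theorem IsMagnifier.sq_mul_sum_normSq_le {γ : ℝ} (hγ : 0 ≤ γ) {G : InvGraph V E}
    (hG : G.IsMagnifier γ) {Δ : ℕ} (hΔ : ∀ v, G.deg v ≤ Δ) (h : V → ℂ) (hh : ∑ v, h v = 0) :
    γ ^ 2 * ∑ v, Complex.normSq (h v) ≤
      4 * Δ * ∑ e, Complex.normSq (h (G.t e) - h (G.h e)) := by
  have h1 := hG.sq_mul_sum_sq_le hγ hΔ (fun v => (h v).re) (by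
    rw [← Complex.re_sum, hh, Complex.zero_re])
  have h2 := hG.sq_mul_sum_sq_le hγ hΔ (fun v => (h v).im) (by
    rw [← Complex.im_sum, hh, Complex.zero_im])
  have h3 := add_le_add h1 h2
  rw [← mul_add, ← mul_add, ← Finset.sum_add_distrib, ← Finset.sum_add_distrib] at h3
  simpa only [Complex.normSq_apply, Complex.sub_re, Complex.sub_im, ← pow_two] using h3

/-- A magnifier has no solutions `f * h` of the Ihara-Bass equation, with `h` of sum zero, at
points near that of a positive solution `f`. -/
theorem IsMagnifier.gap_le {γ : ℝ} (hγ : 0 ≤ γ) {G : InvGraph V E} (hG : G.IsMagnifier γ) {Δ : ℕ}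
    (hΔ : ∀ v, G.deg v ≤ Δ) {f : V → ℝ} {a b : ℝ} (ha : 0 < a) (haf : ∀ v, a ≤ f v)
    (hfb : ∀ v, f v ≤ b) {ℓ : ℝ} (hℓ : 1 ≤ ℓ)
    (hf : ∀ v, (ℓ ^ 2 - 1 + G.deg v) * f v = ℓ * G.adj f v)
    {z : ℂ} (hz : 1 ≤ ‖z‖) {h : V → ℂ} (hne : h ≠ 0) (hsum : ∑ v, h v = 0)
    (hh : ∀ v, (z ^ 2 - 1 + G.deg v) * (f v * h v) = z * G.adj (fun w => (f w : ℂ) * h w) v) :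
    γ ^ 2 * a ^ 2 ≤ 8 * Δ * (Δ + 2) * b ^ 2 * ‖z - ℓ‖ := by
  have hf0 : ∀ v, 0 < f v := fun v => ha.trans_le (haf v)
  have hz0 : z ≠ 0 := norm_pos_iff.1 (by linarith)
  have hℓ0 : (ℓ : ℂ) ≠ 0 := by
    rw [Ne, Complex.ofReal_eq_zero]
    linarith
  set X := ∑ v, Complex.normSq (h v) with hX
  have hXpos : 0 < X := by
    obtain ⟨v, hv⟩ := Function.ne_iff.1 hne
    exact Finset.sum_pos' (fun _ _ => Complex.normSq_nonneg _)
      ⟨v, Finset.mem_univ v, Complex.normSq_pos.2 hv⟩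
  have h1 := hG.sq_mul_sum_normSq_le hγ hΔ h hsum
  have h2 : a ^ 2 * ∑ e, Complex.normSq (h (G.t e) - h (G.h e)) ≤
      ∑ e, f (G.t e) * f (G.h e) * Complex.normSq (h (G.t e) - h (G.h e)) := by
    rw [Finset.mul_sum]
    refine Finset.sum_le_sum fun e _ => mul_le_mul_of_nonneg_right ?_ (Complex.normSq_nonneg _)
    rw [pow_two]
    exact mul_le_mul (haf _) (haf _) ha.le (hf0 _).le
  have h3 : ∀ v, f v * Complex.normSq (h v) * G.adj f v -
        ((starRingEnd ℂ) (f v * h v) * G.adj (fun w => (f w : ℂ) * h w) v).re ≤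
      (Δ + 2) * b ^ 2 * ‖z - ℓ‖ * Complex.normSq (h v) := by
    intro v
    have h4 : G.adj (fun w => (f w : ℂ) * h w) v = (z ^ 2 - 1 + G.deg v) / z * (f v * h v) := by
      rw [div_mul_eq_mul_div, hh, mul_div_cancel_left₀ _ hz0]
    have h5 : ((G.adj f v : ℝ) : ℂ) = (ℓ ^ 2 - 1 + G.deg v) / ℓ * f v := by
      rw [div_mul_eq_mul_div, eq_div_iff hℓ0]
      have := congrArg Complex.ofReal (hf v)
      push_cast at this
      rw [this, mul_comm]
    -- Both adjacency values come from the factor `(x² - 1 + deg) / x`, at `x = ℓ` and `x = z`.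
    -- Their difference is divisible by `z - ℓ`, with cofactor bounded by `Δ + 2` because `|ℓ z| ≥
    -- 1`.
    have h6 : f v * Complex.normSq (h v) * G.adj f v -
        ((starRingEnd ℂ) (f v * h v) * G.adj (fun w => (f w : ℂ) * h w) v).re =
        (((f v ^ 2 * Complex.normSq (h v) : ℝ) : ℂ) *
          ((z - ℓ) * ((G.deg v - 1) / (ℓ * z) - 1))).re := by
      have h7 : (starRingEnd ℂ) (f v * h v) * G.adj (fun w => (f w : ℂ) * h w) v =
          ((f v ^ 2 * Complex.normSq (h v) : ℝ) : ℂ) * ((z ^ 2 - 1 + G.deg v) / z) := by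
        rw [h4, map_mul, Complex.conj_ofReal]
        push_cast
        rw [Complex.normSq_eq_conj_mul_self]
        ring
      have h8 : f v * Complex.normSq (h v) * G.adj f v =
          (((f v ^ 2 * Complex.normSq (h v) : ℝ) : ℂ) * ((ℓ ^ 2 - 1 + G.deg v) / ℓ)).re := by
        rw [← Complex.ofReal_re (f v * Complex.normSq (h v) * G.adj f v)]
        congr 1
        push_cast
        rw [h5]
        ring
      rw [h7, h8, ← Complex.sub_re, ← mul_sub]
      congr 2
      field_simp
      ring
    rw [h6, Complex.re_ofReal_mul]
    have h9 : ((z - ℓ) * ((G.deg v - 1) / (ℓ * z) - 1)).re ≤ ‖z - ℓ‖ * (Δ + 2) := by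
      refine (Complex.re_le_norm _).trans ?_
      rw [norm_mul]
      refine mul_le_mul_of_nonneg_left ?_ (norm_nonneg _)
      have h10 : ‖((G.deg v : ℂ) - 1) / (ℓ * z)‖ ≤ Δ + 1 := by
        rw [norm_div]
        refine (div_le_self (norm_nonneg _) ?_).trans ((norm_sub_le _ _).trans ?_)
        · rw [norm_mul, Complex.norm_real, Real.norm_of_nonneg (by linarith)]
          exact one_le_mul_of_one_le_of_one_le hℓ hz
        · have : (G.deg v : ℝ) ≤ Δ := by exact_mod_cast hΔ v
          simpa using this
      refine (norm_sub_le _ _).trans ?_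
      rw [norm_one]
      linarith
    have h11 : f v ^ 2 ≤ b ^ 2 := pow_le_pow_left₀ (hf0 v).le (hfb v) 2
    calc f v ^ 2 * Complex.normSq (h v) * ((z - ℓ) * ((G.deg v - 1) / (ℓ * z) - 1)).re
        ≤ f v ^ 2 * Complex.normSq (h v) * (‖z - ℓ‖ * (Δ + 2)) :=
          mul_le_mul_of_nonneg_left h9 (mul_nonneg (sq_nonneg _) (Complex.normSq_nonneg _))
      _ ≤ b ^ 2 * Complex.normSq (h v) * (‖z - ℓ‖ * (Δ + 2)) := by
          have := Complex.normSq_nonneg (h v)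
          gcongr
      _ = _ := by ring
  have h12 := Finset.sum_le_sum fun v (_ : v ∈ Finset.univ) => h3 v
  rw [← Finset.mul_sum] at h12
  rw [G.sum_ground_state_eq] at h2
  have h13 : (γ ^ 2 * a ^ 2) * X ≤ (8 * Δ * (Δ + 2) * b ^ 2 * ‖z - ℓ‖) * X := by
    calc (γ ^ 2 * a ^ 2) * X = a ^ 2 * (γ ^ 2 * X) := by ring
      _ ≤ a ^ 2 * (4 * Δ * ∑ e, Complex.normSq (h (G.t e) - h (G.h e))) := by gcongr
      _ = 4 * Δ * (a ^ 2 * ∑ e, Complex.normSq (h (G.t e) - h (G.h e))) := by ring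
      _ ≤ 4 * Δ * (2 * ((Δ + 2) * b ^ 2 * ‖z - ℓ‖ * X)) := by
        refine mul_le_mul_of_nonneg_left (h2.trans ?_) (by positivity)
        exact mul_le_mul_of_nonneg_left h12 two_pos.le
      _ = _ := by ring
  exact le_of_mul_le_mul_right h13 hXpos

end gap

end InvGraph

/-! ### Covers: tangles, magnifiers and the new spectrum -/

namespace InvGraph

section cover

open Matrix

variable {V E K : Type*} [Fintype V] [DecidableEq V] [Fintype E] [DecidableEq E]
  {B : InvGraph V E} {n : ℕ}

namespace Coord

theorem tailSum_cover [AddCommMonoid K] (σ : B.Coord n) (F : E × Fin n → K) (v : V) (i : Fin n) :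
    σ.cover.tailSum F (v, i) = B.tailSum (fun e => F (e, i)) v := by
  simp only [tailSum]
  refine (Finset.sum_bij (fun e _ => (e, i)) ?_ ?_ ?_ fun _ _ => rfl).symm
  · intro e he
    simpa [cover] using he
  · intro e _ e' _ h
    exact (Prod.ext_iff.1 h).1
  · rintro ⟨e, j⟩ he
    simp only [cover, Finset.mem_filter, Finset.mem_univ, true_and, Prod.mk.injEq] at he
    exact ⟨e, by simp [he.1], by rw [he.2]⟩

theorem adj_cover [AddCommMonoid K] (σ : B.Coord n) (f : V → K) (p : V × Fin n) :
    σ.cover.adj (fun q => f q.1) p = B.adj f p.1 :=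
  σ.tailSum_cover _ _ _

theorem deg_cover (σ : B.Coord n) (p : V × Fin n) : σ.cover.deg p = B.deg p.1 := by
  have h1 := σ.cover.tailSum_const (1 : ℤ) p
  have h2 := B.tailSum_const (1 : ℤ) p.1
  rw [mul_one] at h1 h2
  have h3 : (σ.cover.deg p : ℤ) = (B.deg p.1 : ℤ) := by
    rw [← h1, ← h2]
    exact σ.tailSum_cover (fun _ => (1 : ℤ)) p.1 p.2
  exact_mod_cast h3

/-- A set of vertices of a cover closed under passing to neighbours meets every fibre. -/
theorem exists_mem_fibre (hB : B.Connected) (σ : B.Coord n) {W : Finset (V × Fin n)}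
    (hW : W.Nonempty) (hcl : ∀ e, σ.cover.t e ∈ W → σ.cover.h e ∈ W) (v : V) :
    ∃ i, (v, i) ∈ W := by
  obtain ⟨⟨u, j⟩, hu⟩ := hW
  have := hB.2 u v
  induction this with
  | refl => exact ⟨j, hu⟩
  | tail _ h ih =>
    obtain ⟨e, rfl, rfl⟩ := h
    obtain ⟨i, hi⟩ := ih
    exact ⟨σ.1 e i, hcl (e, i) hi⟩

/-- The subgraph of a graph on a set of vertices closed under passing to neighbours. -/
def _root_.InvGraph.closedSubgraph {V E : Type*} [DecidableEq V] [Fintype E] (G : InvGraph V E)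
    (W : Finset V) (hcl : ∀ e, G.t e ∈ W → G.h e ∈ W) : G.Subgraph where
  verts := W
  edges := Finset.univ.filter fun e => G.t e ∈ W
  t_mem e he := (Finset.mem_filter.1 he).2
  h_mem e he := hcl e (Finset.mem_filter.1 he).2
  ι_mem e he := Finset.mem_filter.2 ⟨Finset.mem_univ _, by
    rw [G.t_ι]
    exact hcl e (Finset.mem_filter.1 he).2⟩

/-- A closed set keeps every edge at its vertices, so Hashimoto equations restrict to it unchanged.
-/
theorem _root_.InvGraph.tailSum_closedSubgraph [AddCommMonoid K] (G : InvGraph V E) (W : Finset V)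
    (hcl : ∀ e, G.t e ∈ W → G.h e ∈ W) (F : E → K)
    (x : {v // v ∈ (G.closedSubgraph W hcl).verts}) :
    (G.closedSubgraph W hcl).toGraph.tailSum (fun e => F e.1) x = G.tailSum F x.1 := by
  simp only [tailSum]
  refine Finset.sum_bij (fun e _ => e.1) ?_ ?_ ?_ fun _ _ => rfl
  · intro e he
    have := (Finset.mem_filter.1 he).2
    exact Finset.mem_filter.2 ⟨Finset.mem_univ _, congrArg Subtype.val this⟩
  · intro e _ e' _ h
    exact Subtype.ext h
  · intro e he
    have h1 := (Finset.mem_filter.1 he).2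
    have h2 : e ∈ (G.closedSubgraph W hcl).edges :=
      Finset.mem_filter.2 ⟨Finset.mem_univ _, h1 ▸ x.2⟩
    exact ⟨⟨e, h2⟩, Finset.mem_filter.2 ⟨Finset.mem_univ _, Subtype.ext h1⟩, rfl⟩

/-- The pullback of a Perron function of `B` is an eigenfunction here with the same eigenvalue. It
is nonzero because `W` meets every fibre. -/
theorem mu1_le_mu1_closedSubgraph (hB : B.Connected) (σ : B.Coord n) {W : Finset (V × Fin n)}
    (hW : W.Nonempty) (hcl : ∀ e, σ.cover.t e ∈ W → σ.cover.h e ∈ W) :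
    B.mu1 ≤ (σ.cover.closedSubgraph W hcl).toGraph.mu1 := by
  rcases isEmpty_or_nonempty E with hE | hE
  · have : B.mu1 = 0 := by
      rw [mu1, Subsingleton.elim B.hashimoto 0]
      simp
    rw [this]
    exact mu1_nonneg _
  obtain ⟨g, -, hgne, hg⟩ := B.exists_perron_function
  set F : E × Fin n → ℂ := fun p => (g p.1 : ℂ) with hF
  obtain ⟨e₀, he₀⟩ := Function.ne_iff.1 hgne
  obtain ⟨i, hi⟩ := σ.exists_mem_fibre hB hW hcl (B.t e₀)
  have hmem : (e₀, i) ∈ (σ.cover.closedSubgraph W hcl).edges :=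
    Finset.mem_filter.2 ⟨Finset.mem_univ _, hi⟩
  have h := (σ.cover.closedSubgraph W hcl).toGraph.norm_le_mu1 (z := (B.mu1 : ℂ))
    (g := fun e => F e.1) (fun h0 => he₀ (by simpa [hF] using congrFun h0 ⟨(e₀, i), hmem⟩)) (by
      ext ⟨⟨e, j⟩, he⟩
      rw [hashimoto_mulVec_apply, tailSum_closedSubgraph]
      change σ.cover.tailSum F (B.h e, σ.1 e j) - (g (B.ι e) : ℂ) = B.mu1 * g e
      rw [tailSum_cover, ← Complex.ofReal_mul, hg]
      simp [hF, tailSum])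
  rwa [Complex.norm_real, Real.norm_of_nonneg B.mu1_nonneg] at h

theorem _root_.InvGraph.order_closedSubgraph_le (G : InvGraph V E) (W : Finset V)
    (hcl : ∀ e, G.t e ∈ W → G.h e ∈ W) {Δ : ℕ} (hΔ : ∀ v, G.deg v ≤ Δ) :
    (G.closedSubgraph W hcl).toGraph.order ≤ (W.card * Δ : ℕ) := by
  set S := G.closedSubgraph W hcl with hS
  have h1 : Nat.card S.toGraph.Edge ≤ S.edges.card := by
    have : Nat.card S.toGraph.Edge ≤ Nat.card {e // e ∈ S.edges} :=
      Nat.card_le_card_of_surjective (Quotient.mk S.toGraph.edgeSetoid) Quotient.mk_surjective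
    simpa using this
  have h2 : S.edges.card ≤ W.card * Δ := by
    refine Finset.card_le_mul_card_image_of_maps_to (f := G.t) (fun e he => S.t_mem e he) Δ ?_ |>.trans
      (mul_comm _ _).le
    intro v _
    refine (Finset.card_le_card ?_).trans (hΔ v)
    intro e he
    simpa using (Finset.mem_filter.1 he).2
  rw [order]
  have : (Nat.card S.toGraph.Edge : ℤ) ≤ (W.card * Δ : ℕ) := by exact_mod_cast h1.trans h2
  omega

theorem _root_.InvGraph.connected_closedSubgraph (G : InvGraph V E) (W : Finset V)
    (hcl : ∀ e, G.t e ∈ W → G.h e ∈ W) (u : V) (hu : u ∈ W)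
    (hW : ∀ w ∈ W, Relation.ReflTransGen (fun a b => ∃ e, G.t e = a ∧ G.h e = b) u w) :
    (G.closedSubgraph W hcl).toGraph.Connected := by
  set S := G.closedSubgraph W hcl with hS
  set r := fun a b => ∃ e, S.toGraph.t e = a ∧ S.toGraph.h e = b with hr
  have hsymm : Std.Symm r := ⟨by
    rintro _ _ ⟨e, rfl, rfl⟩
    exact ⟨S.toGraph.ι e, S.toGraph.t_ι e, S.toGraph.h_ι e⟩⟩
  have key : ∀ w, Relation.ReflTransGen (fun a b => ∃ e, G.t e = a ∧ G.h e = b) u w →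
      ∃ hw : w ∈ S.verts, Relation.ReflTransGen r ⟨u, hu⟩ ⟨w, hw⟩ := by
    intro w hw
    induction hw with
    | refl => exact ⟨hu, Relation.ReflTransGen.refl⟩
    | tail _ h ih =>
      obtain ⟨e, rfl, rfl⟩ := h
      obtain ⟨hb, hrb⟩ := ih
      exact ⟨hcl e hb, hrb.tail ⟨⟨e, Finset.mem_filter.2 ⟨Finset.mem_univ _, hb⟩⟩, rfl, rfl⟩⟩
  refine ⟨⟨⟨u, hu⟩⟩, fun x y => ?_⟩
  obtain ⟨hx, hx'⟩ := key x.1 (hW _ x.2)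
  obtain ⟨hy, hy'⟩ := key y.1 (hW _ y.2)
  exact (Relation.ReflTransGen.stdSymm.symm _ _ hx').trans hy'

/-- In a tangle-free cover, small sets of vertices have neighbours outside. -/
theorem nonempty_nbhd_sdiff (hB : B.Connected) (σ : B.Coord n) {ν : ℝ} (hν : ν ≤ B.mu1) {r : ℕ}
    (hr : σ.cover.TangleFree ν r) {U : Finset (V × Fin n)} (hU : U.Nonempty)
    (hUr : U.card * Fintype.card E < r) : (σ.cover.nbhd U \ U).Nonempty := by
  classical
  by_contra hne
  rw [Finset.not_nonempty_iff_eq_empty, Finset.sdiff_eq_empty_iff_subset] at hne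
  obtain ⟨u, hu⟩ := hU
  -- A tangle must be connected, so `U` is replaced by the component of one of its vertices.
  set W := Finset.univ.filter fun w =>
    Relation.ReflTransGen (fun a b => ∃ e, σ.cover.t e = a ∧ σ.cover.h e = b) u w with hW
  have hmem : ∀ w, w ∈ W ↔
      Relation.ReflTransGen (fun a b => ∃ e, σ.cover.t e = a ∧ σ.cover.h e = b) u w := fun w => by
    simp [hW]
  have huW : u ∈ W := (hmem u).2 Relation.ReflTransGen.refl
  have hcl : ∀ e, σ.cover.t e ∈ W → σ.cover.h e ∈ W := fun e he =>
    (hmem _).2 (((hmem _).1 he).tail ⟨e, rfl, rfl⟩)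
  have hsub : W ⊆ U := fun w hw => by
    have := (hmem w).1 hw
    clear hw
    induction this with
    | refl => exact hu
    | tail _ h ih =>
      obtain ⟨e, rfl, rfl⟩ := h
      exact hne (mem_nbhd.2 ⟨e, ih, rfl⟩)
  have horder := σ.cover.order_closedSubgraph_le W hcl (Δ := Fintype.card E) fun v => by
    rw [deg_cover]
    exact B.deg_le _
  refine hr (σ.cover.closedSubgraph W hcl) ⟨?_, ?_, ?_⟩
  · exact σ.cover.connected_closedSubgraph W hcl u huW fun w hw => (hmem w).1 hw
  · exact hν.trans (σ.mu1_le_mu1_closedSubgraph hB ⟨u, huW⟩ hcl)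
  · refine horder.trans_lt ?_
    exact_mod_cast (Nat.mul_le_mul_right _ (Finset.card_le_card hsub)).trans_lt hUr

/-- A tangle-free cover that is a pseudo-magnifier is a magnifier. -/
theorem isMagnifier_of_tangleFree (hB : B.Connected) (σ : B.Coord n) {ν : ℝ} (hν : ν ≤ B.mu1)
    {R : ℕ} (hR : 1 ≤ R) {γ : ℝ} (hr : σ.cover.TangleFree ν (R * Fintype.card E + 1))
    (hσ : σ.cover.IsPseudoMagnifier R γ) : σ.cover.IsMagnifier (min γ (1 / R)) := by
  intro U hU hU2
  have hR0 : (0 : ℝ) < R := by exact_mod_cast hR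
  by_cases hRU : R ≤ U.card
  · refine le_trans ?_ (hσ U hRU hU2)
    exact mul_le_mul_of_nonneg_right (min_le_left _ _) (Nat.cast_nonneg _)
  · have h1 := (σ.nonempty_nbhd_sdiff hB hν hr hU
      (Nat.lt_succ_of_le (Nat.mul_le_mul_right _ (by omega)))).card_pos
    have h2 : (U.card : ℝ) ≤ R := by exact_mod_cast (not_le.1 hRU).le
    calc min γ (1 / R) * (U.card : ℝ) ≤ 1 / R * R :=
          mul_le_mul (min_le_right _ _) h2 (Nat.cast_nonneg _) (by positivity)
      _ = 1 := by field_simp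
      _ ≤ _ := by exact_mod_cast h1

theorem exists_of_mem_newSpec (σ : B.Coord n) {z : ℂ} (hz : z ∈ σ.newSpec) :
    ∃ g ∈ newFunctions E n, g ≠ 0 ∧
      ∀ e, z * g e = σ.cover.tailSum g (σ.cover.h e) - g (σ.cover.ι e) := by
  rw [newSpec, Polynomial.mem_roots (LinearMap.charpoly_monic _).ne_zero,
    ← Module.End.hasEigenvalue_iff_isRoot_charpoly] at hz
  obtain ⟨g, hg⟩ := hz.exists_hasEigenvector
  refine ⟨g.1, g.2, fun h => hg.2 (Subtype.ext h), fun e => ?_⟩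
  have h1 := congrArg Subtype.val hg.apply_eq_smul
  have h2 : σ.cover.hashimoto *ᵥ g.1 = z • g.1 := h1
  rw [← hashimoto_mulVec_apply, h2]
  rfl

open Classical in
theorem newCount_le (σ : B.Coord n) (ℓ : ℂ) (ρ : ℝ) : σ.newCount ℓ ρ ≤ Fintype.card E * n := by
  refine (Multiset.card_le_card (Multiset.filter_le _ _)).trans ((Polynomial.card_roots' _).trans ?_)
  rw [LinearMap.charpoly_natDegree]
  refine (Submodule.finrank_le _).trans ?_
  simp

open Classical in
theorem newCount_eq_zero (σ : B.Coord n) {ℓ : ℂ} {ρ : ℝ} (h : ∀ z ∈ σ.newSpec, ρ < ‖z - ℓ‖) :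
    σ.newCount ℓ ρ = 0 := by
  rw [newCount, Multiset.card_eq_zero, Multiset.filter_eq_nil]
  intro z hz hz'
  rw [Metric.mem_closedBall, dist_eq_norm] at hz'
  exact absurd hz' (not_le.2 (h z hz))

theorem tailSum_newFunctions (σ : B.Coord n) {g : E × Fin n → ℂ} (hg : g ∈ newFunctions E n)
    (v : V) : ∑ i, σ.cover.tailSum g (v, i) = 0 := by
  simp only [tailSum_cover]
  simp only [tailSum]
  rw [Finset.sum_comm]
  exact Finset.sum_eq_zero fun e _ => hg e

/-- Spectral gap: the new eigenvalues of large magnifying covers stay away from the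
Perron-Frobenius eigenvalue of the base. -/
theorem exists_gap (hB : B.Connected) {γ : ℝ} (hγ : 0 < γ) :
    ∃ δ : ℝ, 0 < δ ∧ ∃ N : ℕ, ∀ n, N ≤ n → ∀ σ : B.Coord n, σ.cover.IsMagnifier γ →
      ∀ z ∈ σ.newSpec, δ < ‖z - B.mu1‖ := by
  have hΔ : ∀ {n} (σ : B.Coord n) p, σ.cover.deg p ≤ Fintype.card E := fun σ p => by
    rw [deg_cover]
    exact B.deg_le _
  have hVne : Nonempty V := hB.1
  rcases le_or_gt B.mu1 1 with h1 | h1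
  -- Here magnifying covers have bounded size, so beyond `N` there are none and any `δ` serves.
  · obtain ⟨N, hN⟩ := exists_nat_gt (1 + 6 * (Fintype.card E : ℕ) / γ)
    refine ⟨1, one_pos, N, fun n hn σ hσ => ?_⟩
    exfalso
    have hN0 : 0 < N := by
      have h2 : 0 ≤ 6 * (Fintype.card E : ℝ) / γ := by positivity
      have h3 : (0 : ℝ) < N := by linarith
      exact_mod_cast h3
    have : NeZero n := ⟨by omega⟩
    have h2 := hσ.card_le_of_card_edge_le hγ (by
      have := Nat.mul_le_mul_right n (card_edge_le_of_mu1_le_one hB h1)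
      simpa [Fintype.card_prod, mul_assoc] using this) (hΔ σ)
    have h3 : n ≤ Fintype.card (V × Fin n) := by
      rw [Fintype.card_prod, Fintype.card_fin]
      exact Nat.le_mul_of_pos_left _ Fintype.card_pos
    have h4 : (N : ℝ) ≤ Fintype.card (V × Fin n) := by exact_mod_cast hn.trans h3
    linarith
  obtain ⟨f, hf0, hf⟩ := exists_pos_ground_state hB h1
  obtain ⟨v₀, -, hv₀⟩ := Finset.exists_min_image Finset.univ f Finset.univ_nonempty
  obtain ⟨v₁, -, hv₁⟩ := Finset.exists_max_image Finset.univ f Finset.univ_nonempty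
  set a := f v₀
  set b := f v₁
  set ℓ := B.mu1
  set Δ := Fintype.card E
  have ha : 0 < a := hf0 v₀
  set k : ℝ := 8 * Δ * (Δ + 2) * b ^ 2 with hk
  have hk0 : 0 ≤ k := by positivity
  have hpos : 0 < γ ^ 2 * a ^ 2 := by positivity
  -- The first bound keeps `‖z‖ > 1`; the second contradicts `gap_le`, and `k + 1` makes the
  -- contradiction strict and avoids dividing by zero.
  refine ⟨min ((ℓ - 1) / 2) (γ ^ 2 * a ^ 2 / (k + 1)), lt_min (by linarith) (by positivity), 0,
    fun n _ σ hσ z hz => ?_⟩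
  by_contra! hle
  obtain ⟨hz1, hz2⟩ := le_min_iff.1 hle
  obtain ⟨g, hgnew, hgne, hg⟩ := σ.exists_of_mem_newSpec hz
  have hznorm : 1 < ‖z‖ := by
    have h2 : ‖(ℓ : ℂ)‖ ≤ ‖z‖ + ‖z - ℓ‖ := by
      rw [norm_sub_rev]
      exact norm_le_norm_add_norm_sub' _ _
    rw [Complex.norm_real, Real.norm_of_nonneg (by linarith)] at h2
    linarith
  have hzsq : z ^ 2 - 1 ≠ 0 := fun h => by
    have h2 : ‖z‖ ^ 2 = 1 := by rw [← norm_pow, sub_eq_zero.1 h, norm_one]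
    nlinarith
  have hg' : ∀ e, z * g e = σ.cover.tailSum g (σ.cover.h e) - g (σ.cover.ι e) + 0 := by
    simpa using hg
  set S := σ.cover.tailSum g with hS
  set h : V × Fin n → ℂ := fun p => S p / f p.1 with hh
  have hfh : ∀ p : V × Fin n, (f p.1 : ℂ) * h p = S p := fun p =>
    mul_div_cancel₀ _ (Complex.ofReal_ne_zero.2 (hf0 p.1).ne')
  -- If all vertex sums vanish, the edge identity reads `(z² - 1) g = 0`, and `z² ≠ 1` forces `g =
  -- 0`.
  have hne : h ≠ 0 := fun h0 => by
    have hS0 : ∀ p, S p = 0 := fun p => by rw [← hfh, h0, Pi.zero_apply, mul_zero]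
    refine hgne (funext fun e => ?_)
    have h2 := σ.cover.edge_eq_of_hashimoto_eq hg' e
    rw [← hS, hS0, hS0] at h2
    simpa [hzsq] using h2
  have hsum : ∑ p, h p = 0 := by
    rw [Fintype.sum_prod_type]
    refine Finset.sum_eq_zero fun v _ => ?_
    simp only [hh]
    rw [← Finset.sum_div, hS, σ.tailSum_newFunctions hgnew, zero_div]
  have hgap := hσ.gap_le hγ.le (hΔ σ) (f := fun p => f p.1) (a := a) (b := b) ha
    (fun p => hv₀ _ (Finset.mem_univ _)) (fun p => hv₁ _ (Finset.mem_univ _)) h1.le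
    (fun p => by
      rw [deg_cover, adj_cover]
      exact hf p.1) hznorm.le hne hsum fun p => by
        have h2 := σ.cover.vertex_eq_of_hashimoto_eq hg' p
        rw [mul_zero, zero_mul, add_zero] at h2
        simp only [hfh]
        exact h2
  have h2 : k * ‖z - ℓ‖ ≤ k * (γ ^ 2 * a ^ 2 / (k + 1)) := by gcongr
  have h3 : k * (γ ^ 2 * a ^ 2 / (k + 1)) < γ ^ 2 * a ^ 2 := by
    rw [← mul_div_assoc, div_lt_iff₀ (by linarith)]
    linarith
  linarith

end Coord

end cover

/-! ### Expectations, and the conclusion -/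

namespace Model

variable {V E : Type*} [Fintype E] [DecidableEq E] {B : InvGraph V E}

theorem expect_mono (M : B.Model) (n : M.degrees) {X Y : B.Coord n → ℝ} (h : ∀ σ, X σ ≤ Y σ) :
    M.expect n X ≤ M.expect n Y :=
  Finset.sum_le_sum fun σ _ => mul_le_mul_of_nonneg_left (h σ) ENNReal.toReal_nonneg

theorem expect_const_mul (M : B.Model) (n : M.degrees) (c : ℝ) (X : B.Coord n → ℝ) :
    M.expect n (fun σ => c * X σ) = c * M.expect n X := by
  simp only [expect, Finset.mul_sum]
  exact Finset.sum_congr rfl fun σ _ => mul_left_comm _ _ _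

theorem expect_const (M : B.Model) (n : M.degrees) (c : ℝ) : M.expect n (fun _ => c) = c := by
  let : Fintype (B.Coord n) := Fintype.ofFinite _
  have h : ∑ σ : B.Coord n, (M.law n σ).toReal = 1 := by
    rw [← ENNReal.toReal_sum fun σ _ => (M.law n).apply_ne_top σ, ← tsum_fintype (L := .unconditional _),
      (M.law n).tsum_coe, ENNReal.toReal_one]
  rw [expect, ← Finset.sum_mul, h, one_mul]

end Model

end InvGraph

open Classical in
theorem lemma4p3 {V : Type*} {E : Type*} [Fintype V] [DecidableEq V] [Fintype E] [DecidableEq E]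
    (B : InvGraph V E) (hB : B.Connected) (M : B.Model) (hM : M.PseudoMagnifying)
    (i : ℕ) (hi : 1 ≤ i) (θ : ℝ) (hθ : 0 < θ) :
    ∃ r : ℕ, 1 ≤ r ∧ ∃ C : ℝ, ∀ ν : ℝ, ν ≤ B.mu1 → ∀ n : M.degrees,
      M.expect n (fun σ => (if σ.cover.TangleFree ν r then 1 else 0) *
          (σ.newCount (B.mu1 : ℂ) (((n : ℕ) : ℝ) ^ (-θ)) : ℝ))
        ≤ C * ((n : ℕ) : ℝ) ^ (-(i : ℝ)) := by
  -- The extra power of `n` pays for the trivial bound `#E * n` on the count.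
  obtain ⟨γ, hγ, R, hR, c, hc⟩ := hM (i + 1) (by omega)
  have hγ' : 0 < min γ (1 / R) := lt_min hγ (by
    have : (0 : ℝ) < R := by exact_mod_cast hR
    positivity)
  obtain ⟨δ, hδ, N, hN⟩ := InvGraph.Coord.exists_gap hB hγ'
  obtain ⟨N', hN'⟩ : ∃ N' : ℕ, ∀ n : ℕ, N' ≤ n → (n : ℝ) ^ (-θ) ≤ δ := by
    have := ((tendsto_rpow_neg_atTop hθ).comp tendsto_natCast_atTop_atTop).eventually_le_const hδ
    exact Filter.eventually_atTop.1 this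
  set N₀ := max N N'
  set m : ℝ := (Fintype.card E : ℝ) with hm
  have hm0 : 0 ≤ m := Nat.cast_nonneg _
  -- The two terms of the constant serve `n ≥ N₀` and `n < N₀`; in the latter range the trivial
  -- bound on the count suffices.
  refine ⟨R * Fintype.card E + 1, by omega, m * |c| + m * N₀ ^ (i + 1), fun ν hν n => ?_⟩
  have hn0 : (0 : ℝ) < (n : ℕ) := by exact_mod_cast M.pos n n.2
  have hcount : ∀ σ : B.Coord n,
      (σ.newCount (B.mu1 : ℂ) (((n : ℕ) : ℝ) ^ (-θ)) : ℝ) ≤ m * (n : ℕ) := fun σ => by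
    rw [hm]
    exact_mod_cast σ.newCount_le _ _
  rcases le_or_gt N₀ n with hn | hn
  · have h1 : ∀ σ : B.Coord n, (if σ.cover.TangleFree ν (R * Fintype.card E + 1) then 1 else 0) *
        (σ.newCount (B.mu1 : ℂ) (((n : ℕ) : ℝ) ^ (-θ)) : ℝ) ≤
        m * (n : ℕ) * (if ¬ σ.cover.IsPseudoMagnifier R γ then 1 else 0) := fun σ => by
      by_cases hT : σ.cover.TangleFree ν (R * Fintype.card E + 1)
      · rw [if_pos hT, one_mul]
        by_cases hP : σ.cover.IsPseudoMagnifier R γ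
        · have h2 := hN n ((le_max_left _ _).trans hn) σ
            (σ.isMagnifier_of_tangleFree hB hν hR hT hP)
          rw [σ.newCount_eq_zero fun z hz =>
            (hN' n ((le_max_right _ _).trans hn)).trans_lt (h2 z hz)]
          simp [hP]
        · rw [if_pos hP, mul_one]
          exact hcount σ
      · rw [if_neg hT, zero_mul]
        split_ifs <;> positivity
    refine (M.expect_mono n h1).trans ?_
    rw [M.expect_const_mul]
    have h3 : M.expect n (fun σ => if ¬ σ.cover.IsPseudoMagnifier R γ then 1 else 0) ≤
        |c| * ((n : ℕ) : ℝ) ^ (-((i + 1 : ℕ) : ℝ)) := by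
      have h4 := (hc n).trans (mul_le_mul_of_nonneg_right (le_abs_self c) (by positivity))
      rw [InvGraph.Model.prob] at h4
      refine le_of_eq_of_le ?_ h4
      congr!
    calc m * (n : ℕ) * M.expect n (fun σ => if ¬ σ.cover.IsPseudoMagnifier R γ then 1 else 0)
        ≤ m * (n : ℕ) * (|c| * ((n : ℕ) : ℝ) ^ (-((i + 1 : ℕ) : ℝ))) := by gcongr
      _ = m * |c| * ((n : ℕ) : ℝ) ^ (-(i : ℝ)) := by
        rw [Real.rpow_neg hn0.le, Real.rpow_neg hn0.le, Real.rpow_natCast, Real.rpow_natCast]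
        field_simp
        ring
      _ ≤ _ := by
        refine mul_le_mul_of_nonneg_right ?_ (by positivity)
        exact le_add_of_nonneg_right (by positivity)
  · have h1 : ∀ σ : B.Coord n, (if σ.cover.TangleFree ν (R * Fintype.card E + 1) then 1 else 0) *
        (σ.newCount (B.mu1 : ℂ) (((n : ℕ) : ℝ) ^ (-θ)) : ℝ) ≤ m * (n : ℕ) := fun σ => by
      refine le_trans ?_ (hcount σ)
      split_ifs <;> simp
    refine (M.expect_mono n h1).trans ?_
    rw [M.expect_const]
    have h2 : ((n : ℕ) : ℝ) ^ (i + 1) ≤ (N₀ : ℝ) ^ (i + 1) := by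
      gcongr
    calc m * (n : ℕ) = m * ((n : ℕ) : ℝ) ^ (i + 1) * ((n : ℕ) : ℝ) ^ (-(i : ℝ)) := by
          rw [Real.rpow_neg hn0.le, Real.rpow_natCast]
          field_simp
          ring
      _ ≤ m * N₀ ^ (i + 1) * ((n : ℕ) : ℝ) ^ (-(i : ℝ)) := by gcongr
      _ ≤ _ := by
        refine mul_le_mul_of_nonneg_right ?_ (by positivity)
        exact le_add_of_nonneg_left (by positivity)
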